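/- Let $n\ge 1$, let $f(\cdot,i):\mathbb R^d\to\mathbb R$, $i=1,\dots,n$, be differentiable, $f=\frac1n\sum_{i=1}^n f(\cdot,i)$, let $\varphi:\mathbb R^d\to(-\infty,\infty]$, and let $\psi=f+\varphi$. For $h:\mathbb R^d\to(-\infty,\infty]$ let $\operatorname{dom}h=\{x: h(x)<\infty\}$ and let $\partial h(x)$ be the Fréchet subdifferential, i.e., for $x\in\operatorname{dom}h$ the set of all $g$ with $h(y)\ge h(x)+\langle g,y-x\rangle+o(\|y-x\|)$ as $y\to x$, and $\partial h(x)=\emptyset$ otherwise; $\operatorname{dist}(0,\emptyset)=\infty$; $\operatorname{crit}\psi=\{w\in\operatorname{dom}\varphi: 0\in\partial\psi(w)\}$. Assume: (F.1) each $\nabla f(\cdot,i)$ is Lipschitz continuous on $\operatorname{dom}\varphi$ with modulus $L>0$; (F.2) $\varphi$ is lower semicontinuous, proper and $\rho$-weakly convex, i.e., $\varphi+\frac\rho2\|\cdot\|^2$ is convex, where $\rho\ge 0$; (F.3) there are $f_{\rm lb},\varphi_{\rm lb}\in\mathbb R$ with $f(w,i)\ge f_{\rm lb}$ and $\varphi(w)\ge\varphi_{\rm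 lb}$ for all $w\in\operatorname{dom}\varphi$ and all $i$. Let $\lambda>0$ with $4\lambda\rho<1$, and $\operatorname{prox}_{\lambda\varphi}(z)=\operatorname{argmin}_y\,\varphi(y)+\frac1{2\lambda}\|z-y\|^2$. Let $\alpha_k=\alpha/(\beta+k)^\gamma$ with $\alpha>0$, $\beta\ge0$, $\gamma\in(\frac12,1]$. Let $\{w^k\}_{k\ge1}$ be generated by the norm-PRR method: $z^1\in\mathbb R^d$, $w^1=\operatorname{prox}_{\lambda\varphi}(z^1)$ and, for $k=1,2,\dots$, with an arbitrary permutation $\pi^k$ of $\{1,\dots,n\}$ and $z^k_1=z^k$, $w^k_1=w^k$, $$z^k_{i+1}=z^k_i-\alpha_k\bigl(\nabla f(w^k_i,\pi^k_i)+\tfrac1\lambda(z^k_i-w^k_i)\bigr),\qquad w^k_{i+1}=\operatorname{prox}_{\lambda\varphi}(z^k_{i+1}),\qquad i=1,\dots,n,$$ and $z^{k+1}=z^k_{n+1}$, $w^{k+1}=w^k_{n+1}$. We say that $\psi$ has the KL property at $\bar w$ with exponent $\theta\in[0,1)$ and constant $c>0$ if there are $\eta\in(0,\infty]$ and a neighborhood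 $U$ of $\bar w$ such that $|\psi(w)-\psi(\bar w)|^\theta\le c\cdot\operatorname{dist}(0,\partial\psi(w))$ for all $w\in U$ with $0<|\psi(w)-\psi(\bar w)|<\eta$. Assume: (K.1) $\{w^k\}_k$ is bounded; (K.2) $\psi$ has the KL property, with some exponent in $[0,1)$ and some constant, at every accumulation point of $\{w^k\}_k$. Then $\{w^k\}_k$ converges to some $w^*\in\operatorname{crit}\psi$. Moreover, whenever $\psi$ has the KL property at $w^*$ with exponent $\theta\in[0,1)$ and constant $c>0$, the following rates hold as $k\to\infty$. (a) If $\gamma\in(\frac12,1)$ and $0\le\theta<\frac{\gamma}{3\gamma-1}$, then $$\max\{\operatorname{dist}(0,\partial\psi(w^k))^2,|\psi(w^k)-\psi(w^*)|\}=\mathcal O(k^{-(3\gamma-1)})\quad\text{and}\quad\|w^k-w^*\|=\mathcal O(k^{-(2\gamma-1)}).$$ (b) If $\gamma\in(\frac12,1)$ and $\frac{\gamma}{3\gamma-1}\le\theta<1$, then $$\max\{\operatorname{dist}(0,\partial\psi(w^k))^2,|\psi(w^k)-\psi(w^*)|\}=\mathcal O\bigl(k^{-\frac{1-\gamma}{2\theta-1}}\bigr)\quad\text{and}\quad\|w^k-w^*\|=\mathcal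 O\bigl(k^{-\frac{(1-\theta)(1-\gamma)}{2\theta-1}}\bigr).$$ (c) Let $\tau=\frac{1-4\lambda\rho}{2(1-2\lambda\rho+\lambda^2L^2)}$ and $\tilde c=c+\max\{1,\frac{\tau\lambda}2\}$. If $\gamma=1$, $\theta\in[0,\frac12]$ and $\alpha>\frac{16\tilde c^2}{\tau n}$, then $$\max\{\operatorname{dist}(0,\partial\psi(w^k))^2,|\psi(w^k)-\psi(w^*)|\}=\mathcal O(k^{-2})\quad\text{and}\quad\|w^k-w^*\|=\mathcal O(k^{-1}).$$ -/

import Mathlib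

open Filter Topology
open scoped ENNReal

namespace NormPRR

/-- The space `ℝ^d` with the Euclidean norm. -/
abbrev E (d : ℕ) : Type := EuclideanSpace ℝ (Fin d)

variable {d n : ℕ}

/-- The effective domain of an extended real-valued function. -/
def dom (h : E d → EReal) : Set (E d) := {x | h x ≠ ⊤}

/-- Properness of `h : ℝ^d → (-∞, ∞]`: the value `-∞` is never attained, and `h` is finite
somewhere. -/
def IsProper (h : E d → EReal) : Prop := (∀ x, h x ≠ ⊥) ∧ (dom h).Nonempty

/-- `ρ`-weak convexity of `h : ℝ^d → (-∞, ∞]`: the function `h + (ρ / 2) ‖·‖ ^ 2` is convex, that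
is, its effective domain (which is `dom h`) is convex and the function is convex on it. -/
def IsWeaklyConvex (ρ : ℝ) (h : E d → EReal) : Prop :=
  ConvexOn ℝ (dom h) (fun x => (h x).toReal + ρ / 2 * ‖x‖ ^ 2)

/-- The Fréchet (regular) subdifferential of `h` at `x`: all `g` with
`h y ≥ h x + ⟪g, y - x⟫ + o(‖y - x‖)` as `y → x`. It is empty where `h` is not finite. -/
def frechetSubdiff (h : E d → EReal) (x : E d) : Set (E d) :=
  {g | h x ≠ ⊤ ∧ h x ≠ ⊥ ∧ ∀ ε : ℝ, 0 < ε → ∀ᶠ y in 𝓝 x,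
    h x + ((inner ℝ g (y - x) - ε * ‖y - x‖ : ℝ) : EReal) ≤ h y}

/-- `dist(0, ∂h(x))`, with the convention `dist(0, ∅) = ∞`. -/
noncomputable def stat (h : E d → EReal) (x : E d) : ℝ≥0∞ :=
  Metric.infEDist 0 (frechetSubdiff h x)

/-- The stationary points of `h`. -/
def crit (h : E d → EReal) : Set (E d) := {x | x ∈ dom h ∧ 0 ∈ frechetSubdiff h x}

/-- The proximity operator: `prox lam φ z` is the minimizer of
`y ↦ φ y + (1 / (2 * lam)) * ‖z - y‖ ^ 2`. -/
noncomputable def prox (lam : ℝ) (φ : E d → EReal) (z : E d) : E d :=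
  Classical.epsilon fun w : E d =>
    IsMinOn (fun y : E d => φ y + ((1 / (2 * lam) * ‖z - y‖ ^ 2 : ℝ) : EReal)) Set.univ w

/-- The smooth part `f(w) = (1 / n) ∑ i, f(w, i)`. -/
noncomputable def smoothPart (f : Fin n → E d → ℝ) (w : E d) : ℝ :=
  (1 / (n : ℝ)) * ∑ i, f i w

/-- The composite objective `ψ = f + φ`. -/
noncomputable def obj (f : Fin n → E d → ℝ) (φ : E d → EReal) (w : E d) : EReal :=
  (smoothPart f w : EReal) + φ w

/-- The sequences `z` and `w` (indexed by `k = 1, 2, …`; the values at `k = 0` are irrelevant) are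
generated by the normal map-based proximal random reshuffling method with step sizes `a k`,
parameter `lam` and permutations `π k`. The inner iterates of epoch `k` are `zin k 0, …, zin k n`
and `win k 0, …, win k n`. -/
structure IsGenerated (f : Fin n → E d → ℝ) (φ : E d → EReal) (lam : ℝ) (a : ℕ → ℝ)
    (π : ℕ → Equiv.Perm (Fin n)) (z w : ℕ → E d) (zin win : ℕ → Fin (n + 1) → E d) : Prop where
  init : w 1 = prox lam φ (z 1)
  start_z : ∀ k, 1 ≤ k → zin k 0 = z k
  start_w : ∀ k, 1 ≤ k → win k 0 = w k
  step_z : ∀ k, 1 ≤ k → ∀ i : Fin n, zin k i.succ = zin k i.castSucc -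
    a k • (gradient (f (π k i)) (win k i.castSucc) +
      lam⁻¹ • (zin k i.castSucc - win k i.castSucc))
  step_w : ∀ k, 1 ≤ k → ∀ i : Fin n, win k i.succ = prox lam φ (zin k i.succ)
  next_z : ∀ k, 1 ≤ k → z (k + 1) = zin k (Fin.last n)
  next_w : ∀ k, 1 ≤ k → w (k + 1) = win k (Fin.last n)

/-- The set of accumulation points of a sequence. -/
def accPts (w : ℕ → E d) : Set (E d) :=
  {x | ∃ l : ℕ → ℕ, StrictMono l ∧ Tendsto (fun j => w (l j)) atTop (𝓝 x)}

/-- The function `ψ` satisfies the Kurdyka-Łojasiewicz inequality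
`|ψ w - ψ wbar| ^ θ ≤ c * dist(0, ∂ψ(w))` at `wbar` with exponent `θ ∈ [0, 1)` and constant
`c > 0`, for all `w` in some neighborhood of `wbar` with `0 < |ψ w - ψ wbar| < η`, where
`η ∈ (0, ∞]`. The absolute value `EReal.abs` has values in `[0, ∞]`, so that the restriction
`|ψ w - ψ wbar| < η` excludes points `w` with `ψ w = ∞`. -/
def HasKL (ψ : E d → EReal) (wbar : E d) (θ c : ℝ) : Prop :=
  0 ≤ θ ∧ θ < 1 ∧ 0 < c ∧ ∃ η : ℝ≥0∞, 0 < η ∧ ∃ U ∈ 𝓝 wbar, ∀ w ∈ U,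
    0 < (ψ w - ψ wbar).abs → (ψ w - ψ wbar).abs < η →
      (ψ w - ψ wbar).abs ^ θ ≤ ENNReal.ofReal c * stat ψ w

/-- The parameter `τ` of the merit function. -/
noncomputable def tau (lam ρ L : ℝ) : ℝ :=
  (1 - 4 * lam * ρ) / (2 * (1 - 2 * lam * ρ + lam ^ 2 * L ^ 2))

/-- The adjusted constant `c + max {1, τ lam / 2}` of the merit function. -/
noncomputable def adjustedConst (lam ρ L c : ℝ) : ℝ := c + max 1 (tau lam ρ L * lam / 2)

/-- `u k = O(k ^ (-p))` as `k → ∞`, for a sequence with values in `[0, ∞]` (in particular `u k` is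
finite for all large `k`). -/
def HasRate (u : ℕ → ℝ≥0∞) (p : ℝ) : Prop :=
  ∃ C : ℝ, 0 < C ∧ ∀ᶠ k : ℕ in atTop, u k ≤ ENNReal.ofReal (C * (k : ℝ) ^ (-p))

/-- `max {dist(0, ∂ψ(w))², |ψ(w) - ψ(wstar)|}`, with values in `[0, ∞]`. -/
noncomputable def residual (ψ : E d → EReal) (wstar w : E d) : ℝ≥0∞ :=
  max (stat ψ w ^ 2) (ψ w - ψ wstar).abs

end NormPRR

namespace NormPRR

/-! Write `G k` for the norm of the normal map `F(z) = ∇f(prox z) + λ⁻¹(z - prox z)` at `z k`, and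
`Ψ k` for `ψ (w k)`. Since `F(z)` is a Fréchet subgradient of `ψ` at `prox z`, `G k` dominates
`dist(0, ∂ψ(w k))`. Boundedness of `w` bounds the spread of the component gradients, so an epoch is
a step `-n a_k F(z k)` with an error of order `a_k² (G k + 1)` (`IsGenerated.exists_error_bound`).
Along such steps the merit function `Ψ + σ G²` loses a multiple of `a_k G²`, up to an error of order
`k ^ (-3γ)` (`merit_descent`, `Regular.exists_merit_descent`).

With `p = 3γ - 1`, the error is dominated by the decrements of some `D k ^ (-p)`, so the corrected
merit function is nonincreasing. Its decrease makes `a_k G²` summable; as the step sizes are not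
summable and `G` changes by at most `O(a_k)`, this forces `G → 0`, and `Ψ` converges to some `l`
(`tendsto_of_perturbed_descent`). Accumulation points are then critical with value `l`
(`Regular.mem_crit_of_tendsto`).

The corrected gap `δ` satisfies `δ ^ θ ≤ C (G + k ^ (-pθ))` near an accumulation point.
Desingularizing by `δ ^ (1 - θ)` turns the descent into a telescoping bound on step lengths, with
remainders summable if `γ + θp > 1` and `2γ > 1`; the iterates are trapped near the accumulation
point and converge to it (`tendsto_of_KL`). A KL exponent may be raised, because function gaps are
eventually below one, so this condition and `θ ≥ 1/2` can be arranged.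

For the rates, the KL inequality inserted into the descent gives `δ_{k+1} ≤ δ_k - c k^{-γ} δ_k^{2θ}
+ C k^{-(γ+2θp)}`. A tangent to the convex power reduces this to Chung's lemma
(`nonlinear_recursion_rate`). The distance rate is read off from the tail of the telescoping bound.
-/

/-! ### Power sequences and rates of numerical recursions. -/

lemma rpow_neg_sub_le {r : ℝ} (hr : 0 ≤ r) {k : ℕ} (hk : 1 ≤ k) :
    (k : ℝ) ^ (-r) - ((k + 1 : ℕ) : ℝ) ^ (-r) ≤ r * (k : ℝ) ^ (-(r + 1)) := by
  have hk0 : (0 : ℝ) < k := by exact_mod_cast hk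
  have h1 : ((k + 1 : ℕ) : ℝ) = k * (1 + 1 / k) := by push_cast; field_simp
  have hpos : (0 : ℝ) < 1 + 1 / k := by positivity
  have h2 : 1 - r * (1 / k) ≤ (1 + 1 / (k : ℝ)) ^ (-r) := by
    rw [Real.rpow_def_of_pos hpos]
    have hlog : Real.log (1 + 1 / k) ≤ 1 / k := by
      have := Real.log_le_sub_one_of_pos hpos
      linarith
    have := Real.add_one_le_exp (Real.log (1 + 1 / (k : ℝ)) * -r)
    nlinarith
  rw [h1, Real.mul_rpow hk0.le hpos.le]
  have h3 : (k : ℝ) ^ (-(r + 1)) = (k : ℝ) ^ (-r) * (1 / k) := by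
    rw [neg_add, Real.rpow_add hk0, Real.rpow_neg_one, one_div]
  rw [h3]
  have := mul_le_mul_of_nonneg_left h2 (Real.rpow_nonneg hk0.le (-r))
  linarith

lemma le_rpow_neg_sub {r : ℝ} (hr : 0 ≤ r) {k : ℕ} (hk : 1 ≤ k) :
    r * 2 ^ (-(r + 1)) * (k : ℝ) ^ (-(r + 1)) ≤
      (k : ℝ) ^ (-r) - ((k + 1 : ℕ) : ℝ) ^ (-r) := by
  have hk0 : (0 : ℝ) < k := by exact_mod_cast hk
  have hk1 : (1 : ℝ) ≤ k := by exact_mod_cast hk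
  set m : ℝ := ((k + 1 : ℕ) : ℝ) with hm
  have hmk : m = k + 1 := by rw [hm]; push_cast; ring
  have hm0 : 0 < m := by rw [hmk]; linarith
  have h1 : (k : ℝ) = m * (1 - 1 / m) := by field_simp; rw [hmk]; ring
  have hpos : (0 : ℝ) < 1 - 1 / m := by
    have : 0 < m * (1 - 1 / m) := h1 ▸ hk0
    exact pos_of_mul_pos_right this hm0.le
  have h2 : 1 + r * (1 / m) ≤ (1 - 1 / m) ^ (-r) := by
    rw [Real.rpow_def_of_pos hpos]
    have hlog : Real.log (1 - 1 / m) ≤ - (1 / m) := by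
      have := Real.log_le_sub_one_of_pos hpos
      linarith
    have := Real.add_one_le_exp (Real.log (1 - 1 / m) * -r)
    nlinarith
  have h3 : m ^ (-(r + 1)) = m ^ (-r) * (1 / m) := by
    rw [neg_add, Real.rpow_add hm0, Real.rpow_neg_one, one_div]
  have h4 : (k : ℝ) ^ (-r) = m ^ (-r) * (1 - 1 / m) ^ (-r) := by
    conv_lhs => rw [h1]
    rw [Real.mul_rpow hm0.le hpos.le]
  have h5 : r * m ^ (-(r + 1)) ≤ (k : ℝ) ^ (-r) - m ^ (-r) := by
    rw [h3, h4]
    have := mul_le_mul_of_nonneg_left h2 (Real.rpow_nonneg hm0.le (-r))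
    linarith
  have h6 : (2 : ℝ) ^ (-(r + 1)) * (k : ℝ) ^ (-(r + 1)) ≤ m ^ (-(r + 1)) := by
    rw [← Real.mul_rpow (by norm_num) hk0.le]
    exact Real.rpow_le_rpow_of_nonpos hm0 (by rw [hmk]; linarith) (by linarith)
  calc r * 2 ^ (-(r + 1)) * (k : ℝ) ^ (-(r + 1))
      = r * (2 ^ (-(r + 1)) * (k : ℝ) ^ (-(r + 1))) := by ring
    _ ≤ r * m ^ (-(r + 1)) := by gcongr
    _ ≤ _ := h5

/-- A multiple of `k ^ (-r)` whose decrements dominate a given multiple of `k ^ (-(r + 1))`. -/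
lemma exists_telescoping {r : ℝ} (hr : 0 < r) {C : ℝ} (hC : 0 ≤ C) :
    ∃ D : ℝ, 0 < D ∧ ∀ k : ℕ, 1 ≤ k → C * (k : ℝ) ^ (-(r + 1)) ≤
      D * (k : ℝ) ^ (-r) - D * ((k + 1 : ℕ) : ℝ) ^ (-r) := by
  have h2 : (0 : ℝ) < 2 ^ (-(r + 1)) := by positivity
  refine ⟨(C + 1) / (r * 2 ^ (-(r + 1))), by positivity, fun k hk => ?_⟩
  have h := le_rpow_neg_sub hr.le hk
  have h0 : (0 : ℝ) ≤ (k : ℝ) ^ (-(r + 1)) := by positivity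
  rw [← mul_sub, div_mul_eq_mul_div, le_div_iff₀ (by positivity)]
  have h1 : 0 ≤ r * 2 ^ (-(r + 1)) * (k : ℝ) ^ (-(r + 1)) := by positivity
  have h3 := mul_le_mul_of_nonneg_left h (by linarith : 0 ≤ C + 1)
  linarith

/-- Bernoulli's inequality, rescaled: a convex power lies above its tangent at `y`. It linearizes
the recursion for the merit gap. -/
lemma rpow_ge_tangent {s x y : ℝ} (hs : 1 ≤ s) (hx : 0 ≤ x) (hy : 0 < y) :
    s * y ^ (s - 1) * x - (s - 1) * y ^ s ≤ x ^ s := by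
  have h := one_add_mul_self_le_rpow_one_add (s := x / y - 1) (by
    have : 0 ≤ x / y := by positivity
    linarith) hs
  have h1 : (1 + (x / y - 1)) = x / y := by ring
  rw [h1, Real.div_rpow hx hy.le, le_div_iff₀ (by positivity)] at h
  have h2 : y ^ s = y ^ (s - 1) * y := by
    rw [Real.rpow_sub_one hy.ne']; field_simp
  have h3 : (1 + s * (x / y - 1)) * y ^ s = s * y ^ (s - 1) * x - (s - 1) * y ^ s := by
    rw [h2]; field_simp; ring
  linarith

lemma rpow_le_tangent {s x y : ℝ} (hs0 : 0 ≤ s) (hs : s ≤ 1) (hx : 0 ≤ x) (hy : 0 < y) :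
    x ^ s ≤ y ^ s + s * y ^ (s - 1) * (x - y) := by
  have h := rpow_one_add_le_one_add_mul_self (s := x / y - 1) (by
    have : 0 ≤ x / y := by positivity
    linarith) hs0 hs
  have h1 : (1 + (x / y - 1)) = x / y := by ring
  rw [h1, Real.div_rpow hx hy.le, div_le_iff₀ (by positivity)] at h
  have h2 : y ^ s = y ^ (s - 1) * y := by
    rw [Real.rpow_sub_one hy.ne']; field_simp
  have h3 : (1 + s * (x / y - 1)) * y ^ s = y ^ s + s * y ^ (s - 1) * (x - y) := by
    rw [h2]; field_simp
  linarith

lemma tendsto_natCast_rpow_neg {r : ℝ} (hr : 0 < r) :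
    Tendsto (fun k : ℕ => (k : ℝ) ^ (-r)) atTop (𝓝 0) :=
  (tendsto_rpow_neg_atTop hr).comp tendsto_natCast_atTop_atTop

/-- Chung's lemma for linear recursions. -/
lemma linear_recursion_rate {δ : ℕ → ℝ} {A B q r : ℝ} (hA : 0 < A) (hB : 0 ≤ B) (hq0 : 0 < q)
    (hq : q ≤ 1) (hr : 0 ≤ r) (hAr : q = 1 → r < A)
    (h : ∀ᶠ k : ℕ in atTop, δ (k + 1) ≤ (1 - A * (k : ℝ) ^ (-q)) * δ k
      + B * (k : ℝ) ^ (-(q + r))) :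
    ∃ M : ℝ, 0 < M ∧ ∀ᶠ k : ℕ in atTop, δ k ≤ M * (k : ℝ) ^ (-r) := by
  -- `A₁` measures what the comparison sequence `k ^ (-r)` loses in one step relative to `k ^ (-(q +
  -- r))`. For `q = 1` the two orders agree and `A₁ = r`, hence the need for `r < A`; for `q < 1`
  -- the loss is of lower order.
  obtain ⟨A₁, hA₁, hev⟩ : ∃ A₁ < A, ∀ᶠ k : ℕ in atTop,
      r * (k : ℝ) ^ (-(r + 1)) ≤ A₁ * (k : ℝ) ^ (-(q + r)) := by
    rcases hq.eq_or_lt with h1 | h1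
    · refine ⟨r, hAr h1, Eventually.of_forall fun k => ?_⟩
      rw [h1, add_comm]
    · refine ⟨A / 2, by linarith, ?_⟩
      have h2 : Tendsto (fun k : ℕ => r * (k : ℝ) ^ (-(1 - q))) atTop (𝓝 (r * 0)) :=
        (tendsto_natCast_rpow_neg (by linarith)).const_mul r
      rw [mul_zero] at h2
      filter_upwards [h2.eventually_le_const (show 0 < A / 2 by linarith),
        eventually_ge_atTop 1] with k hk hk1
      have hk0 : (0 : ℝ) < k := by exact_mod_cast hk1
      have h3 : (k : ℝ) ^ (-(r + 1)) = (k : ℝ) ^ (-(1 - q)) * (k : ℝ) ^ (-(q + r)) := by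
        rw [← Real.rpow_add hk0]; congr 1; ring
      rw [h3, ← mul_assoc]
      gcongr
  have h4 : Tendsto (fun k : ℕ => A * (k : ℝ) ^ (-q)) atTop (𝓝 (A * 0)) :=
    (tendsto_natCast_rpow_neg hq0).const_mul A
  rw [mul_zero] at h4
  obtain ⟨K, hK⟩ := eventually_atTop.1 (h.and (hev.and
    ((h4.eventually_le_const zero_lt_one).and (eventually_ge_atTop 1))))
  have hK0 : (0 : ℝ) < K := by exact_mod_cast (hK K le_rfl).2.2.2
  -- The first entry lets the surplus `A - A₁` absorb `B` in the induction step; the second starts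
  -- the induction at `K`.
  set M := max (B / (A - A₁) + 1) (δ K * (K : ℝ) ^ r) with hM
  have hAA : 0 < A - A₁ := by linarith
  have hM1 : B ≤ M * (A - A₁) := by
    rw [← div_le_iff₀ hAA]
    exact (by linarith : B / (A - A₁) ≤ B / (A - A₁) + 1).trans (le_max_left _ _)
  have hM0 : 0 < M := lt_of_lt_of_le (by positivity) (le_max_left _ _)
  refine ⟨M, hM0, eventually_atTop.2 ⟨K, fun k hk => ?_⟩⟩
  induction k, hk using Nat.le_induction with
  | base =>
    have h5 : δ K * (K : ℝ) ^ r ≤ M := le_max_right _ _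
    rw [Real.rpow_neg hK0.le, ← div_eq_mul_inv, le_div_iff₀ (by positivity)]
    exact h5
  | succ k hk ih =>
    obtain ⟨h6, h7, h8, h9⟩ := hK k hk
    have hk0 : (0 : ℝ) < k := by exact_mod_cast h9
    have h10 := rpow_neg_sub_le hr h9
    have h11 : (k : ℝ) ^ (-(q + r)) = (k : ℝ) ^ (-q) * (k : ℝ) ^ (-r) := by
      rw [← Real.rpow_add hk0]; congr 1; ring
    have h12 : 0 ≤ (k : ℝ) ^ (-(q + r)) := by positivity
    have h13 : (1 - A * (k : ℝ) ^ (-q)) * δ k ≤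
        (1 - A * (k : ℝ) ^ (-q)) * (M * (k : ℝ) ^ (-r)) :=
      mul_le_mul_of_nonneg_left ih (by linarith)
    have h14 := mul_le_mul_of_nonneg_left (h10.trans h7) hM0.le
    have h15 := mul_le_mul_of_nonneg_right hM1 h12
    have h16 : (1 - A * (k : ℝ) ^ (-q)) * (M * (k : ℝ) ^ (-r)) =
        M * (k : ℝ) ^ (-r) - A * M * (k : ℝ) ^ (-(q + r)) := by rw [h11]; ring
    nlinarith

/-- Replacing `δ ^ s` by its tangent at the conjectured size `m k ^ (-r)` yields a linear recursion
with `q = γ + (s - 1) r`. In the critical case `q = 1` the coefficient `c s m ^ (s - 1)` must exceed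
`r`, which a large `m` ensures because `s > 1`. -/
lemma nonlinear_recursion_rate {δ : ℕ → ℝ} {c C s γ p r : ℝ} (hc : 0 < c) (hC : 0 ≤ C)
    (hs : 1 ≤ s) (hγ : 0 < γ) (hr : 0 ≤ r) (hrp : r ≤ p)
    (hq : γ + (s - 1) * r < 1 ∨ γ + (s - 1) * r = 1 ∧ 1 < s)
    (hδ : ∀ᶠ k : ℕ in atTop, 0 ≤ δ k)
    (h : ∀ᶠ k : ℕ in atTop, δ (k + 1) ≤ δ k - c * (k : ℝ) ^ (-γ) * δ k ^ s
      + C * (k : ℝ) ^ (-(γ + s * p))) :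
    ∃ M : ℝ, 0 < M ∧ ∀ᶠ k : ℕ in atTop, δ k ≤ M * (k : ℝ) ^ (-r) := by
  obtain ⟨m, hm, hmA⟩ : ∃ m : ℝ, 0 < m ∧
      (γ + (s - 1) * r = 1 → r < c * s * m ^ (s - 1)) := by
    rcases hq with h1 | ⟨h1, h2⟩
    · exact ⟨1, one_pos, fun h => absurd h h1.ne⟩
    · have hcs : 0 < c * s := by positivity
      refine ⟨((r + 1) / (c * s)) ^ (1 / (s - 1)), by positivity, fun _ => ?_⟩
      rw [← Real.rpow_mul (by positivity), one_div, inv_mul_cancel₀ (by linarith),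
        Real.rpow_one, mul_div_cancel₀ _ hcs.ne']
      linarith
  have hs1 : 0 ≤ s - 1 := by linarith
  have hq1 : γ + (s - 1) * r ≤ 1 := by
    rcases hq with h1 | ⟨h1, -⟩
    · exact h1.le
    · exact h1.le
  refine linear_recursion_rate (A := c * s * m ^ (s - 1)) (B := C + c * (s - 1) * m ^ s)
    (q := γ + (s - 1) * r) (by positivity) (by positivity) (by positivity) hq1 hr hmA ?_
  filter_upwards [h, hδ, eventually_ge_atTop 1] with k hk hk0 hk1
  have hkp : (0 : ℝ) < k := by exact_mod_cast hk1
  have hk1' : (1 : ℝ) ≤ k := by exact_mod_cast hk1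
  have hy : 0 < m * (k : ℝ) ^ (-r) := by positivity
  have ht := rpow_ge_tangent hs hk0 hy
  have e1 : (m * (k : ℝ) ^ (-r)) ^ (s - 1) = m ^ (s - 1) * (k : ℝ) ^ (-r * (s - 1)) := by
    rw [Real.mul_rpow hm.le (by positivity), ← Real.rpow_mul hkp.le]
  have e2 : (m * (k : ℝ) ^ (-r)) ^ s = m ^ s * (k : ℝ) ^ (-r * s) := by
    rw [Real.mul_rpow hm.le (by positivity), ← Real.rpow_mul hkp.le]
  have e3 : (k : ℝ) ^ (-γ) * (k : ℝ) ^ (-r * (s - 1)) = (k : ℝ) ^ (-(γ + (s - 1) * r)) := by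
    rw [← Real.rpow_add hkp]; congr 1; ring
  have e4 : (k : ℝ) ^ (-γ) * (k : ℝ) ^ (-r * s) = (k : ℝ) ^ (-(γ + (s - 1) * r + r)) := by
    rw [← Real.rpow_add hkp]; congr 1; ring
  have e5 : (k : ℝ) ^ (-(γ + s * p)) ≤ (k : ℝ) ^ (-(γ + (s - 1) * r + r)) := by
    apply Real.rpow_le_rpow_of_exponent_le hk1'
    have := mul_le_mul_of_nonneg_left hrp (by linarith : 0 ≤ s)
    nlinarith
  rw [e1, e2] at ht
  have ht' := mul_le_mul_of_nonneg_left ht (by positivity : 0 ≤ c * (k : ℝ) ^ (-γ))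
  have e6 : c * (k : ℝ) ^ (-γ) * (s * (m ^ (s - 1) * (k : ℝ) ^ (-r * (s - 1))) * δ k -
      (s - 1) * (m ^ s * (k : ℝ) ^ (-r * s))) =
      c * s * m ^ (s - 1) * (k : ℝ) ^ (-(γ + (s - 1) * r)) * δ k -
        c * (s - 1) * m ^ s * (k : ℝ) ^ (-(γ + (s - 1) * r + r)) := by
    rw [← e3, ← e4]; ring
  rw [e6] at ht'
  have := mul_le_mul_of_nonneg_left e5 hC
  linarith

/-! ### Monotone sequences and vanishing of the criticality measure. -/

lemma exists_tendsto_of_le_succ {V : ℕ → ℝ} {K : ℕ} {B : ℝ} (h : ∀ k, K ≤ k → V (k + 1) ≤ V k)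
    (hB : ∀ k, K ≤ k → B ≤ V k) : ∃ l, Tendsto V atTop (𝓝 l) := by
  have hanti : Antitone fun k => V (k + K) := antitone_nat_of_succ_le fun k => by
    have := h (k + K) (by omega)
    rwa [show k + 1 + K = k + K + 1 by omega]
  refine ⟨_, (tendsto_add_atTop_iff_nat K).1 (tendsto_atTop_ciInf hanti ⟨B, ?_⟩)⟩
  rintro _ ⟨k, rfl⟩
  exact hB _ (by omega)

lemma le_of_tendsto_of_le_succ {V : ℕ → ℝ} {K : ℕ} {l : ℝ} (h : ∀ k, K ≤ k → V (k + 1) ≤ V k)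
    (hl : Tendsto V atTop (𝓝 l)) {k : ℕ} (hk : K ≤ k) : l ≤ V k := by
  refine le_of_tendsto hl (eventually_atTop.2 ⟨k, fun m hm => ?_⟩)
  induction m, hm using Nat.le_induction with
  | base => exact le_rfl
  | succ m hm ih => exact (h m (hk.trans hm)).trans ih

/-- Summing the decreases for a positive `x` would bound `∑ k ^ (-γ)`, which diverges for `γ ≤ 1`.
-/
lemma nonpos_of_divergent_decrease {V : ℕ → ℝ} {K : ℕ} {B b γ x : ℝ} (hb : 0 < b) (hγ : γ ≤ 1)
    (h : ∀ k : ℕ, K ≤ k → V (k + 1) ≤ V k - b * (k : ℝ) ^ (-γ) * x)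
    (hB : ∀ k, K ≤ k → B ≤ V k) : x ≤ 0 := by
  by_contra! hx
  have hsum : ∀ N, ∑ j ∈ Finset.range N, ((j + K : ℕ) : ℝ) ^ (-γ) ≤ (V K - B) / (b * x) := by
    intro N
    have h1 : b * x * ∑ j ∈ Finset.range N, ((j + K : ℕ) : ℝ) ^ (-γ) ≤ V K - V (N + K) := by
      induction N with
      | zero => simp
      | succ N ih =>
        rw [Finset.sum_range_succ, mul_add]
        have := h (N + K) (by omega)
        rw [show N + 1 + K = N + K + 1 by omega]
        nlinarith
    rw [le_div_iff₀ (by positivity)]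
    have := hB (N + K) (by omega)
    nlinarith
  have h2 : Summable fun j : ℕ => ((j + K : ℕ) : ℝ) ^ (-γ) :=
    summable_of_sum_range_le (fun _ => by positivity) hsum
  have h3 := (summable_nat_add_iff (f := fun j : ℕ => (j : ℝ) ^ (-γ)) K).1 h2
  rw [Real.summable_nat_rpow] at h3
  linarith

/-- A nonnegative sequence that is square summable against divergent step sizes and has
controlled increments vanishes. -/
lemma tendsto_zero_of_sq_decrease {G V : ℕ → ℝ} {K : ℕ} {b B M C₁ γ : ℝ}
    (hK : 1 ≤ K) (hγ : 1 / 2 < γ) (hγ' : γ ≤ 1) (hb : 0 < b) (hM : 0 ≤ M) (hC₁ : 0 ≤ C₁)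
    (hG : ∀ k, 0 ≤ G k) (hGM : ∀ k, K ≤ k → G k ≤ M)
    (hV : ∀ k : ℕ, K ≤ k → V (k + 1) ≤ V k - b * (k : ℝ) ^ (-γ) * G k ^ 2)
    (hVB : ∀ k, K ≤ k → B ≤ V k)
    (hGs : ∀ k : ℕ, K ≤ k → G (k + 1) ≤ G k + C₁ * (k : ℝ) ^ (-γ)) :
    Tendsto G atTop (𝓝 0) := by
  -- `G ^ 3` grows in one step by at most `3 C₁ k^{-γ} G²` plus a term of order `k^{-2γ}`. The first
  -- part is cancelled by the decrease of `c V`, the second by that of `D₂ k^{-(2γ-1)}`, so the sum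
  -- of the three is nonincreasing and `G ^ 3` converges.
  obtain ⟨D₂, hD₂, hD₂t⟩ := exists_telescoping (r := 2 * γ - 1) (by linarith)
    (C := (3 * M + C₁) * C₁ ^ 2) (by positivity)
  obtain ⟨c, hc0, hc⟩ : ∃ c : ℝ, 0 ≤ c ∧ c * b = 3 * C₁ :=
    ⟨3 * C₁ / b, by positivity, div_mul_cancel₀ _ hb.ne'⟩
  have hV' : ∀ k, K ≤ k → V (k + 1) ≤ V k := fun k hk => by
    have h1 := hV k hk
    have h2 : 0 ≤ b * (k : ℝ) ^ (-γ) * G k ^ 2 := by positivity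
    linarith
  have hTs : ∀ k : ℕ, K ≤ k →
      G (k + 1) ^ 3 + c * V (k + 1) + D₂ * ((k + 1 : ℕ) : ℝ) ^ (-(2 * γ - 1)) ≤
      G k ^ 3 + c * V k + D₂ * (k : ℝ) ^ (-(2 * γ - 1)) := fun k hk => by
    have hkp : (0 : ℝ) < k := by exact_mod_cast hK.trans hk
    have hk1 : (1 : ℝ) ≤ k := by exact_mod_cast hK.trans hk
    have h1 := hD₂t k (hK.trans hk)
    have h2 := mul_le_mul_of_nonneg_left (hV k hk) hc0
    have h3 := hGs k hk
    have h0 := hG k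
    have h0' := hGM k hk
    have hx0 : 0 ≤ (k : ℝ) ^ (-γ) := by positivity
    have hx1 : (k : ℝ) ^ (-γ) ≤ 1 := Real.rpow_le_one_of_one_le_of_nonpos hk1 (by linarith)
    have hx2 : (k : ℝ) ^ (-(2 * γ - 1 + 1)) = ((k : ℝ) ^ (-γ)) ^ 2 := by
      rw [← Real.rpow_natCast, ← Real.rpow_mul hkp.le]; congr 1; push_cast; ring
    rw [hx2] at h1
    generalize (k : ℝ) ^ (-γ) = x at *
    have h3' : G (k + 1) ^ 3 ≤ (G k + C₁ * x) ^ 3 := pow_le_pow_left₀ (hG (k + 1)) h3 3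
    have h4 : c * (b * x * G k ^ 2) = 3 * C₁ * x * G k ^ 2 := by rw [← hc]; ring
    have e1 : 3 * G k * (C₁ * x) ^ 2 ≤ 3 * M * (C₁ * x) ^ 2 := by gcongr
    have e2 : (C₁ * x) ^ 3 ≤ C₁ * (C₁ * x) ^ 2 := by
      rw [pow_succ' (C₁ * x) 2]
      exact mul_le_mul_of_nonneg_right (mul_le_of_le_one_right hC₁ hx1) (sq_nonneg _)
    have e3 : (G k + C₁ * x) ^ 3 =
        G k ^ 3 + 3 * C₁ * x * G k ^ 2 + 3 * G k * (C₁ * x) ^ 2 + (C₁ * x) ^ 3 := by ring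
    have e4 : (3 * M + C₁) * C₁ ^ 2 * x ^ 2 = 3 * M * (C₁ * x) ^ 2 + C₁ * (C₁ * x) ^ 2 := by ring
    linarith
  have hTB : ∀ k : ℕ, K ≤ k → c * B ≤ G k ^ 3 + c * V k + D₂ * (k : ℝ) ^ (-(2 * γ - 1)) :=
    fun k hk => by
    have h1 := mul_le_mul_of_nonneg_left (hVB k hk) hc0
    have h2 : 0 ≤ D₂ * (k : ℝ) ^ (-(2 * γ - 1)) := by positivity
    have h3 : 0 ≤ G k ^ 3 := pow_nonneg (hG k) 3
    linarith
  obtain ⟨lV, hlV⟩ := exists_tendsto_of_le_succ hV' hVB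
  obtain ⟨lT, hlT⟩ := exists_tendsto_of_le_succ
    (V := fun k : ℕ => G k ^ 3 + c * V k + D₂ * (k : ℝ) ^ (-(2 * γ - 1))) hTs hTB
  have hG3 : Tendsto (fun k => G k ^ 3) atTop (𝓝 (lT - c * lV - D₂ * 0)) := by
    refine ((hlT.sub (hlV.const_mul c)).sub ((tendsto_natCast_rpow_neg (r := 2 * γ - 1)
      (by linarith)).const_mul D₂)).congr fun k => ?_
    ring
  obtain ⟨g, hGg⟩ : ∃ g, Tendsto G atTop (𝓝 g) := by
    refine ⟨_, (hG3.rpow_const (Or.inr (by norm_num : (0 : ℝ) ≤ 1 / 3))).congr fun k => ?_⟩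
    rw [← Real.rpow_natCast, ← Real.rpow_mul (hG k)]
    norm_num
  have hg0 : 0 ≤ g := ge_of_tendsto' hGg hG
  rcases hg0.eq_or_lt with h | hgp
  · rwa [← h] at hGg
  exfalso
  -- A positive limit `g` would keep `G` above `g / 2`, so that `V` decreases without bound.
  obtain ⟨K', hK'⟩ := eventually_atTop.1 (hGg.eventually_const_le (half_lt_self hgp))
  have := nonpos_of_divergent_decrease (V := V) (K := max K K') (x := (g / 2) ^ 2) hb hγ'
    (fun k hk => by
      have h1 := hV k ((le_max_left _ _).trans hk)
      have h2 := hK' k ((le_max_right _ _).trans hk)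
      have h3 : b * (k : ℝ) ^ (-γ) * (g / 2) ^ 2 ≤ b * (k : ℝ) ^ (-γ) * G k ^ 2 := by gcongr
      linarith) (fun k hk => hVB k ((le_max_left _ _).trans hk))
  have h4 : 0 < (g / 2) ^ 2 := by positivity
  linarith

/-- The criticality measure of a perturbed descent method vanishes and its objective values
converge. -/
lemma tendsto_of_perturbed_descent {G Ψ a : ℕ → ℝ} {K : ℕ} {a₀ A₀ b σ B C C' γ p : ℝ}
    (hK : 1 ≤ K) (hγ : 1 / 2 < γ) (hγ' : γ ≤ 1) (hp : 0 < p) (ha₀ : 0 < a₀) (hA₀ : 0 < A₀)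
    (hb : 0 < b) (hσ : 0 < σ) (hC : 0 ≤ C) (hC' : 0 ≤ C') (hG : ∀ k, 0 ≤ G k)
    (ha : ∀ k : ℕ, 1 ≤ k → a₀ * (k : ℝ) ^ (-γ) ≤ a k)
    (ha' : ∀ k : ℕ, 1 ≤ k → a k ≤ A₀ * (k : ℝ) ^ (-γ))
    (hdesc : ∀ k : ℕ, K ≤ k → Ψ (k + 1) + σ * G (k + 1) ^ 2 ≤
      Ψ k + σ * G k ^ 2 - b * a k * G k ^ 2 + C * (k : ℝ) ^ (-(p + 1)))
    (hlb : ∀ k, 1 ≤ k → B ≤ Ψ k)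
    (hlip : ∀ k, 1 ≤ k → G (k + 1) ≤ G k + C' * a k * (G k + 1)) :
    Tendsto G atTop (𝓝 0) ∧ ∃ l, Tendsto Ψ atTop (𝓝 l) := by
  obtain ⟨D, hD, hDt⟩ := exists_telescoping hp hC
  obtain ⟨V, hV⟩ : ∃ V : ℕ → ℝ, ∀ k : ℕ, V k = Ψ k + σ * G k ^ 2 + D * (k : ℝ) ^ (-p) :=
    ⟨_, fun _ => rfl⟩
  have hVs : ∀ k : ℕ, K ≤ k → V (k + 1) ≤ V k - b * a₀ * (k : ℝ) ^ (-γ) * G k ^ 2 := by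
    intro k hk
    have h1 := hdesc k hk
    have h2 := hDt k (hK.trans hk)
    have h3 : b * (a₀ * (k : ℝ) ^ (-γ)) * G k ^ 2 ≤ b * a k * G k ^ 2 := by
      gcongr; exact ha k (hK.trans hk)
    rw [hV, hV]
    linarith
  have hVs' : ∀ k, K ≤ k → V (k + 1) ≤ V k := fun k hk => by
    have h1 := hVs k hk
    have h2 : 0 ≤ b * a₀ * (k : ℝ) ^ (-γ) * G k ^ 2 := by positivity
    linarith
  have hVB : ∀ k, K ≤ k → B + σ * G k ^ 2 ≤ V k := fun k hk => by
    have h1 := hlb k (hK.trans hk)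
    have h2 : 0 ≤ D * (k : ℝ) ^ (-p) := by positivity
    rw [hV]
    linarith
  have hVB' : ∀ k, K ≤ k → B ≤ V k := fun k hk => by
    have h1 := hVB k hk
    have h2 : 0 ≤ σ * G k ^ 2 := by positivity
    linarith
  have hVK : ∀ k, K ≤ k → V k ≤ V K := fun k hk => by
    induction k, hk using Nat.le_induction with
    | base => exact le_rfl
    | succ m hm ih => exact (hVs' m hm).trans ih
  -- Only `Ψ` is bounded below by assumption; the term `σ G²` in the nonincreasing `V` is what
  -- bounds `G`.
  obtain ⟨M, hM1, hGM⟩ : ∃ M : ℝ, 1 ≤ M ∧ ∀ k, K ≤ k → G k ≤ M := by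
    have hM1 : 0 ≤ (V K - B) / σ := div_nonneg (by linarith [hVB' K le_rfl]) hσ.le
    refine ⟨(V K - B) / σ + 1, by linarith, fun k hk => ?_⟩
    have h1 : G k ^ 2 ≤ (V K - B) / σ := by
      rw [le_div_iff₀ hσ]
      linarith [hVB k hk, hVK k hk]
    nlinarith [sq_nonneg (G k - 1)]
  have hGs : ∀ k : ℕ, K ≤ k → G (k + 1) ≤ G k + C' * A₀ * (M + 1) * (k : ℝ) ^ (-γ) :=
    fun k hk => by
    have h1 := hlip k (hK.trans hk)
    have h2 : C' * a k * (G k + 1) ≤ C' * (A₀ * (k : ℝ) ^ (-γ)) * (M + 1) := by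
      have h3 := ha' k (hK.trans hk)
      have h4 := hGM k hk
      have h5 := hG k
      gcongr
    linarith
  have hGg := tendsto_zero_of_sq_decrease hK hγ hγ' (mul_pos hb ha₀) (by linarith)
    (by positivity) hG hGM hVs hVB' hGs
  obtain ⟨lV, hlV⟩ := exists_tendsto_of_le_succ hVs' hVB'
  refine ⟨hGg, lV - σ * 0 ^ 2 - D * 0, ?_⟩
  refine ((hlV.sub ((hGg.pow 2).const_mul σ)).sub
    ((tendsto_natCast_rpow_neg hp).const_mul D)).congr fun k => ?_
  rw [hV]
  ring

/-! ### The corrected merit gap: KL inequality, finite length and rates. -/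

/-- The gap of the merit function, corrected by a multiple of `k ^ (-p)`. -/
noncomputable def meritGap (Ψ G : ℕ → ℝ) (l σ D p : ℝ) (k : ℕ) : ℝ :=
  Ψ k - l + σ * G k ^ 2 + D * (k : ℝ) ^ (-p)

lemma tendsto_meritGap {G Ψ : ℕ → ℝ} {l σ D p : ℝ} (hp : 0 < p) (hG : Tendsto G atTop (𝓝 0))
    (hΨ : Tendsto Ψ atTop (𝓝 l)) : Tendsto (meritGap Ψ G l σ D p) atTop (𝓝 0) := by
  have h : Tendsto (meritGap Ψ G l σ D p) atTop (𝓝 (l - l + σ * 0 ^ 2 + D * 0)) :=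
    ((hΨ.sub_const l).add ((hG.pow 2).const_mul σ)).add
      ((tendsto_natCast_rpow_neg hp).const_mul D)
  rwa [show l - l + σ * 0 ^ 2 + D * 0 = 0 by ring] at h

/-- The decrements of `D k ^ (-p)` absorb the error of the descent. The gap is then nonincreasing
with limit zero, hence nonnegative even though `Ψ k - l` may have either sign. -/
lemma exists_meritGap {G Ψ a : ℕ → ℝ} {K : ℕ} {b σ C p l : ℝ}
    (hK : 1 ≤ K) (hp : 0 < p) (hb : 0 < b) (hC : 0 ≤ C) (ha : ∀ k, 1 ≤ k → 0 ≤ a k)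
    (hdesc : ∀ k : ℕ, K ≤ k → Ψ (k + 1) + σ * G (k + 1) ^ 2 ≤
      Ψ k + σ * G k ^ 2 - b * a k * G k ^ 2 + C * (k : ℝ) ^ (-(p + 1)))
    (hG : Tendsto G atTop (𝓝 0)) (hΨ : Tendsto Ψ atTop (𝓝 l)) :
    ∃ D : ℝ, 0 < D ∧ ∀ k, K ≤ k → 0 ≤ meritGap Ψ G l σ D p k ∧
      meritGap Ψ G l σ D p (k + 1) ≤ meritGap Ψ G l σ D p k - b * a k * G k ^ 2 := by
  obtain ⟨D, hD, hDt⟩ := exists_telescoping hp hC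
  have hs : ∀ k, K ≤ k → meritGap Ψ G l σ D p (k + 1) ≤
      meritGap Ψ G l σ D p k - b * a k * G k ^ 2 := fun k hk => by
    have h1 := hdesc k hk
    have h2 := hDt k (hK.trans hk)
    simp only [meritGap]
    linarith
  refine ⟨D, hD, fun k hk => ⟨le_of_tendsto_of_le_succ (fun k hk => ?_)
    (tendsto_meritGap hp hG hΨ) hk, hs k hk⟩⟩
  have h1 := hs k hk
  have h2 : 0 ≤ b * a k * G k ^ 2 := by
    have := ha k (hK.trans hk)
    positivity
  linarith

/-- The KL inequality for the objective carries over to the corrected merit gap. -/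
lemma meritGap_rpow_le {G Ψ : ℕ → ℝ} {l σ D p θ c : ℝ} {k : ℕ} (hσ : 0 ≤ σ) (hD : 0 ≤ D)
    (hθ : 1 / 2 ≤ θ) (hθ' : θ < 1) (hG : 0 ≤ G k) (hG1 : G k ≤ 1)
    (h0 : 0 ≤ meritGap Ψ G l σ D p k) (hkl : |Ψ k - l| ^ θ ≤ c * G k) :
    meritGap Ψ G l σ D p k ^ θ ≤ (|c| + σ ^ θ + 1) * (G k + (D * (k : ℝ) ^ (-p)) ^ θ) := by
  have hθ0 : 0 ≤ θ := by linarith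
  set u := D * (k : ℝ) ^ (-p) with hu
  have hu0 : 0 ≤ u := by positivity
  have h1 : meritGap Ψ G l σ D p k ≤ |Ψ k - l| + σ * G k ^ 2 + u := by
    simp only [meritGap]
    linarith [le_abs_self (Ψ k - l)]
  have h2 := Real.rpow_le_rpow h0 h1 hθ0
  have h3 := Real.rpow_add_le_add_rpow (a := |Ψ k - l| + σ * G k ^ 2) (b := u) (by positivity)
    hu0 hθ0 hθ'.le
  have h4 := Real.rpow_add_le_add_rpow (a := |Ψ k - l|) (b := σ * G k ^ 2) (by positivity)
    (by positivity) hθ0 hθ'.le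
  -- This needs `2θ ≥ 1` together with `G ≤ 1`, and is why KL exponents are raised to at least one
  -- half.
  have h5 : (σ * G k ^ 2) ^ θ ≤ σ ^ θ * G k := by
    rw [Real.mul_rpow hσ (by positivity), ← Real.rpow_natCast, ← Real.rpow_mul hG]
    gcongr
    calc G k ^ (((2 : ℕ) : ℝ) * θ) ≤ G k ^ (1 : ℝ) :=
          Real.rpow_le_rpow_of_exponent_ge' hG hG1 zero_le_one (by push_cast; linarith)
      _ = G k := Real.rpow_one _
  have h6 : 0 ≤ u ^ θ := by positivity
  have h7 : c * G k ≤ |c| * G k := mul_le_mul_of_nonneg_right (le_abs_self c) hG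
  have h8 : 0 ≤ (|c| + σ ^ θ) * u ^ θ := by positivity
  nlinarith

/-- The tangent to the concave `t ^ (1 - θ)` at `δ` bounds the drop of `δ ^ (1 - θ)` below by a
multiple of `a G² / δ ^ θ`, hence of `a G² / (G + v)` by the KL bound. Since `G² ≥ (G - v)(G + v)`,
this is at least a multiple of `a (G - v)`; the case `G ≤ v` is immediate. -/
lemma step_le_of_desingularized {δ δ' a G v b C₁ θ : ℝ} (hδ : 0 ≤ δ) (hδ' : 0 ≤ δ') (ha : 0 < a)
    (hv : 0 ≤ v) (hb : 0 < b) (hC₁ : 0 < C₁) (hθ : 0 ≤ θ) (hθ' : θ < 1)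
    (hdesc : δ' ≤ δ - b * a * G ^ 2) (hkl : δ ^ θ ≤ C₁ * (G + v)) :
    a * G ≤ C₁ / (b * (1 - θ)) * (δ ^ (1 - θ) - δ' ^ (1 - θ)) + a * v := by
  have h1θ : 0 < 1 - θ := by linarith
  have hle : δ' ≤ δ := by
    have : 0 ≤ b * a * G ^ 2 := by positivity
    linarith
  have hdiff : 0 ≤ δ ^ (1 - θ) - δ' ^ (1 - θ) :=
    sub_nonneg.2 (Real.rpow_le_rpow hδ' hle h1θ.le)
  have hfac : 0 < C₁ / (b * (1 - θ)) := by positivity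
  rcases le_or_gt G v with hGv | hGv
  · have := mul_le_mul_of_nonneg_left hGv ha.le
    have := mul_nonneg hfac.le hdiff
    linarith
  have hGp : 0 < G := lt_of_le_of_lt hv hGv
  have hδp : 0 < δ := by
    have : 0 < b * a * G ^ 2 := by positivity
    linarith
  have ht := rpow_le_tangent h1θ.le (by linarith) hδ' hδp (s := 1 - θ)
  have hZ : 0 < δ ^ θ := by positivity
  have he : δ ^ (1 - θ - 1) = (δ ^ θ)⁻¹ := by
    rw [← Real.rpow_neg hδ]; congr 1; ring
  rw [he] at ht
  have h2 : (1 - θ) * (δ ^ θ)⁻¹ * (b * a * G ^ 2) ≤ δ ^ (1 - θ) - δ' ^ (1 - θ) := by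
    have h3 : (1 - θ) * (δ ^ θ)⁻¹ * (δ' - δ) ≤ (1 - θ) * (δ ^ θ)⁻¹ * (-(b * a * G ^ 2)) := by
      gcongr
      linarith
    linarith
  have h4 : (G - v) / C₁ ≤ (δ ^ θ)⁻¹ * G ^ 2 := by
    rw [div_le_iff₀ hC₁, mul_assoc, ← div_eq_inv_mul, le_div_iff₀ hZ]
    calc (G - v) * δ ^ θ ≤ (G - v) * (C₁ * (G + v)) := by gcongr
      _ ≤ G ^ 2 * C₁ := by nlinarith [mul_nonneg hC₁.le (sq_nonneg v)]
  have h5 : (1 - θ) * b * a * ((G - v) / C₁) ≤ δ ^ (1 - θ) - δ' ^ (1 - θ) := by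
    refine le_trans ?_ h2
    have := mul_le_mul_of_nonneg_left h4 (by positivity : 0 ≤ (1 - θ) * b * a)
    linarith
  have h6 := mul_le_mul_of_nonneg_left h5 hfac.le
  have h7 : C₁ / (b * (1 - θ)) * ((1 - θ) * b * a * ((G - v) / C₁)) = a * (G - v) := by
    field_simp
  linarith

/-- A sequence that is locally of finite length near a cluster point converges to it. -/
lemma tendsto_of_local_length {H : Type*} [NormedAddCommGroup H] {w : ℕ → H} {wbar : H}
    {Y : ℕ → ℝ} {K : ℕ} {r : ℝ} (hr : 0 < r) (hY : ∀ k, K ≤ k → 0 ≤ Y k)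
    (hY0 : Tendsto Y atTop (𝓝 0))
    (hstep : ∀ k, K ≤ k → ‖w k - wbar‖ < r → ‖w (k + 1) - w k‖ ≤ Y k - Y (k + 1))
    (hcl : ∀ ε : ℝ, 0 < ε → ∃ᶠ k in atTop, ‖w k - wbar‖ < ε) :
    Tendsto w atTop (𝓝 wbar) ∧ ∀ᶠ k in atTop, ‖w k - wbar‖ ≤ Y k := by
  -- While the iterates stay in the ball of radius `r`, `‖w k - wbar‖ + Y k` does not increase.
  -- Started below `ε ≤ r`, it can never leave the ball.
  have key : ∀ ε : ℝ, 0 < ε → ε ≤ r → ∃ m, K ≤ m ∧ ∀ k, m ≤ k → ‖w k - wbar‖ < ε := by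
    intro ε hε hεr
    obtain ⟨m, hm1, hm2, hm3⟩ := ((hcl (ε / 2) (by linarith)).and_eventually
      ((hY0.eventually_lt_const (half_pos hε)).and (eventually_ge_atTop K))).exists
    refine ⟨m, hm3, fun k hk => ?_⟩
    have : ‖w k - wbar‖ ≤ ‖w m - wbar‖ + Y m - Y k := by
      induction k, hk using Nat.le_induction with
      | base => linarith
      | succ k hk ih =>
        have h0 := hY k (hm3.trans hk)
        have h1 := hstep k (hm3.trans hk) (by linarith)
        have h2 := norm_add_le (w (k + 1) - w k) (w k - wbar)
        rw [sub_add_sub_cancel] at h2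
        linarith
    have h0 := hY k (hm3.trans hk)
    linarith
  have hlim : Tendsto w atTop (𝓝 wbar) := by
    rw [tendsto_iff_norm_sub_tendsto_zero, Metric.tendsto_atTop]
    intro ε hε
    obtain ⟨m, -, hm⟩ := key (min ε r) (lt_min hε hr) (min_le_right _ _)
    refine ⟨m, fun k hk => ?_⟩
    rw [Real.dist_0_eq_abs, abs_of_nonneg (norm_nonneg _)]
    exact (hm k hk).trans_le (min_le_left _ _)
  refine ⟨hlim, ?_⟩
  obtain ⟨m, hmK, hm⟩ := key r hr le_rfl
  refine eventually_atTop.2 ⟨m, fun k hk => ?_⟩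
  have h1 : ∀ j, k ≤ j → ‖w k - w j‖ ≤ Y k := by
    intro j hj
    have : ‖w k - w j‖ ≤ Y k - Y j := by
      induction j, hj using Nat.le_induction with
      | base => simp
      | succ j hj ih =>
        have h1 := hstep j (hmK.trans (hk.trans hj)) (hm j (hk.trans hj))
        have h2 := norm_add_le (w k - w j) (w j - w (j + 1))
        rw [sub_add_sub_cancel, norm_sub_rev (w j)] at h2
        linarith
    linarith [hY j (hmK.trans (hk.trans hj))]
  exact le_of_tendsto (tendsto_const_nhds.sub hlim).norm (eventually_atTop.2 ⟨k, h1⟩)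

/-- Convergence under the KL inequality, with a bound on the distance to the limit. -/
lemma tendsto_of_KL {H : Type*} [NormedAddCommGroup H] {w : ℕ → H} {wbar : H}
    {G Ψ a : ℕ → ℝ} {K : ℕ} {A₀ b σ D Cs c r γ p θ l : ℝ}
    (hK : 1 ≤ K) (hγ : 1 / 2 < γ) (hb : 0 < b) (hσ : 0 ≤ σ) (hD : 0 ≤ D)
    (hCs : 0 < Cs) (hr : 0 < r) (hθ : 1 / 2 ≤ θ) (hθ' : θ < 1)
    (hq : 0 < γ + θ * p - 1) (hA₀ : 0 < A₀)
    (ha : ∀ k, 1 ≤ k → 0 < a k) (ha' : ∀ k : ℕ, 1 ≤ k → a k ≤ A₀ * (k : ℝ) ^ (-γ))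
    (hG : ∀ k, 0 ≤ G k) (hG1 : ∀ k, K ≤ k → G k ≤ 1)
    (hδ : ∀ k, K ≤ k → 0 ≤ meritGap Ψ G l σ D p k ∧
      meritGap Ψ G l σ D p (k + 1) ≤ meritGap Ψ G l σ D p k - b * a k * G k ^ 2)
    (hδ0 : Tendsto (meritGap Ψ G l σ D p) atTop (𝓝 0))
    (hstep : ∀ k, 1 ≤ k → ‖w (k + 1) - w k‖ ≤ Cs * (a k * G k + a k ^ 2))
    (hkl : ∀ k, K ≤ k → ‖w k - wbar‖ < r → |Ψ k - l| ^ θ ≤ c * G k)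
    (hcl : ∀ ε : ℝ, 0 < ε → ∃ᶠ k in atTop, ‖w k - wbar‖ < ε) :
    Tendsto w atTop (𝓝 wbar) ∧ ∃ M : ℝ, 0 < M ∧ ∀ᶠ k : ℕ in atTop, ‖w k - wbar‖ ≤
      M * (meritGap Ψ G l σ D p k ^ (1 - θ) + (k : ℝ) ^ (-(γ + θ * p - 1)) +
        (k : ℝ) ^ (-(2 * γ - 1))) := by
  set δ := meritGap Ψ G l σ D p with hδdef
  have h1θ : 0 < 1 - θ := by linarith
  set C₁ := |c| + σ ^ θ + 1 with hC₁
  have hC₁0 : 0 < C₁ := by positivity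
  obtain ⟨D₃, hD₃, hD₃t⟩ := exists_telescoping hq (C := A₀ * D ^ θ) (by positivity)
  obtain ⟨D₄, hD₄, hD₄t⟩ := exists_telescoping (r := 2 * γ - 1) (by linarith) (C := A₀ ^ 2)
    (by positivity)
  set C₅ := C₁ / (b * (1 - θ)) with hC₅
  have hC₅0 : 0 < C₅ := by positivity
  -- The three terms pay, by their decrements, for the desingularized descent, for `a_k (D
  -- k^{-p})^θ` of order `k^{-(γ+θp)}`, and for `a_k²` of order `k^{-2γ}`.
  set Y : ℕ → ℝ := fun k => Cs * (C₅ * δ k ^ (1 - θ) + D₃ * (k : ℝ) ^ (-(γ + θ * p - 1)) +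
    D₄ * (k : ℝ) ^ (-(2 * γ - 1))) with hY
  have hYnn : ∀ k, K ≤ k → 0 ≤ Y k := fun k hk => by
    have := (hδ k hk).1
    simp only [hY]
    positivity
  have hY0 : Tendsto Y atTop (𝓝 0) := by
    have h1 := hδ0.rpow_const (p := 1 - θ) (Or.inr h1θ.le)
    have h2 : Tendsto Y atTop (𝓝 (Cs * (C₅ * 0 ^ (1 - θ) + D₃ * 0 + D₄ * 0))) :=
      (((h1.const_mul C₅).add ((tendsto_natCast_rpow_neg hq).const_mul D₃)).add
      ((tendsto_natCast_rpow_neg (r := 2 * γ - 1) (by linarith)).const_mul D₄)).const_mul Cs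
    rwa [Real.zero_rpow h1θ.ne', show Cs * (C₅ * 0 + D₃ * 0 + D₄ * 0) = 0 by ring] at h2
  obtain ⟨hw, hwY⟩ := tendsto_of_local_length hr hYnn hY0 (w := w) (wbar := wbar)
    (fun k hk hkr => by
      have hk1 := hK.trans hk
      have hkp : (0 : ℝ) < k := by exact_mod_cast hk1
      have hv : 0 ≤ (D * (k : ℝ) ^ (-p)) ^ θ := by positivity
      have h1 := meritGap_rpow_le hσ hD hθ hθ' (hG k) (hG1 k hk) (hδ k hk).1 (hkl k hk hkr)
      have h2 := step_le_of_desingularized (hδ k hk).1 (hδ (k + 1) (by omega)).1 (ha k hk1)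
        hv hb hC₁0 (by linarith) hθ' (hδ k hk).2 h1
      have h3 := hD₃t k hk1
      have h4 := hD₄t k hk1
      have h5 : a k * (D * (k : ℝ) ^ (-p)) ^ θ ≤
          A₀ * D ^ θ * (k : ℝ) ^ (-(γ + θ * p - 1 + 1)) := by
        calc a k * (D * (k : ℝ) ^ (-p)) ^ θ
            ≤ A₀ * (k : ℝ) ^ (-γ) * (D * (k : ℝ) ^ (-p)) ^ θ := by
              gcongr; exact ha' k hk1
          _ = _ := by
              rw [Real.mul_rpow hD (by positivity), ← Real.rpow_mul hkp.le,
                show -(γ + θ * p - 1 + 1) = -γ + -p * θ by ring, Real.rpow_add hkp]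
              ring
      have h6 : a k ^ 2 ≤ A₀ ^ 2 * (k : ℝ) ^ (-(2 * γ - 1 + 1)) := by
        calc a k ^ 2 ≤ (A₀ * (k : ℝ) ^ (-γ)) ^ 2 := by
              have := (ha k hk1).le
              gcongr; exact ha' k hk1
          _ = _ := by
              rw [mul_pow, ← Real.rpow_natCast ((k : ℝ) ^ (-γ)), ← Real.rpow_mul hkp.le]
              congr 2; push_cast; ring
      have h7 : a k * G k + a k ^ 2 ≤ C₅ * (δ k ^ (1 - θ) - δ (k + 1) ^ (1 - θ)) +
          (D₃ * (k : ℝ) ^ (-(γ + θ * p - 1)) - D₃ * ((k + 1 : ℕ) : ℝ) ^ (-(γ + θ * p - 1))) +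
          (D₄ * (k : ℝ) ^ (-(2 * γ - 1)) - D₄ * ((k + 1 : ℕ) : ℝ) ^ (-(2 * γ - 1))) := by
        linarith
      have h8 := (hstep k hk1).trans (mul_le_mul_of_nonneg_left h7 hCs.le)
      refine h8.trans (le_of_eq ?_)
      simp only [hY]
      ring) hcl
  refine ⟨hw, Cs * (C₅ + D₃ + D₄), by positivity, ?_⟩
  filter_upwards [hwY, eventually_ge_atTop K] with k hk hkK
  refine hk.trans ?_
  have e1 : 0 ≤ δ k ^ (1 - θ) := Real.rpow_nonneg (hδ k hkK).1 _
  have e2 : 0 ≤ (k : ℝ) ^ (-(γ + θ * p - 1)) := by positivity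
  have e3 : 0 ≤ (k : ℝ) ^ (-(2 * γ - 1)) := by positivity
  simp only [hY]
  rw [mul_assoc]
  refine mul_le_mul_of_nonneg_left ?_ hCs.le
  nlinarith [mul_nonneg hC₅0.le e2, mul_nonneg hC₅0.le e3, mul_nonneg hD₃.le e1,
    mul_nonneg hD₃.le e3, mul_nonneg hD₄.le e1, mul_nonneg hD₄.le e2]

/-- A bound on the merit gap bounds the criticality measure and the objective gap, since the gap
of a second merit function with a smaller weight is nonnegative. -/
lemma sq_and_abs_rate {G Ψ : ℕ → ℝ} {l σ σ' D D' p r M : ℝ} (hσ' : 0 ≤ σ') (hσ : σ' < σ)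
    (hD : 0 ≤ D) (hD' : 0 ≤ D') (hM : 0 < M) (hrp : r ≤ p)
    (hδ' : ∀ᶠ k in atTop, 0 ≤ meritGap Ψ G l σ' D' p k)
    (hδ : ∀ᶠ k : ℕ in atTop, meritGap Ψ G l σ D p k ≤ M * (k : ℝ) ^ (-r)) :
    ∃ M' : ℝ, 0 < M' ∧ ∀ᶠ k : ℕ in atTop, G k ^ 2 ≤ M' * (k : ℝ) ^ (-r) ∧
      |Ψ k - l| ≤ M' * (k : ℝ) ^ (-r) := by
  have hσσ : 0 < σ - σ' := by linarith
  set M₁ := (M + D') / (σ - σ') with hM₁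
  have hM₁0 : 0 < M₁ := by positivity
  refine ⟨M₁ + M + σ' * M₁ + D', by positivity, ?_⟩
  filter_upwards [hδ, hδ', eventually_ge_atTop 1] with k h1 h2 hk
  have hk1 : (1 : ℝ) ≤ k := by exact_mod_cast hk
  have hu : (k : ℝ) ^ (-p) ≤ (k : ℝ) ^ (-r) :=
    Real.rpow_le_rpow_of_exponent_le hk1 (by linarith)
  have hu0 : 0 ≤ (k : ℝ) ^ (-p) := by positivity
  simp only [meritGap] at h1 h2
  generalize (k : ℝ) ^ (-p) = u at *
  generalize (k : ℝ) ^ (-r) = v at *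
  have hv : 0 ≤ v := hu0.trans hu
  have hDu : 0 ≤ D * u := by positivity
  have hDu' := mul_le_mul_of_nonneg_left hu hD'
  -- In the difference of the two gaps `Ψ k - l` cancels and `(σ - σ') G²` remains.
  have hG : G k ^ 2 ≤ M₁ * v := by
    rw [hM₁, div_mul_eq_mul_div, le_div_iff₀ hσσ]
    linarith
  have hσG := mul_le_mul_of_nonneg_left hG hσ'
  have p1 : 0 ≤ M * v := by positivity
  have p2 : 0 ≤ M₁ * v := by positivity
  have p3 : 0 ≤ σ' * (M₁ * v) := by positivity
  have p4 : 0 ≤ D' * v := by positivity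
  have p5 : 0 ≤ σ * G k ^ 2 := mul_nonneg (by linarith) (sq_nonneg _)
  -- The upper bound on `Ψ k - l` comes from the gap with weight `σ`, the lower bound from
  -- nonnegativity of the gap with weight `σ'`.
  refine ⟨by linarith, abs_le.2 ⟨by linarith, by linarith⟩⟩

/-- Squaring the KL bound gives `G² ≥ δ^{2θ} / (2 C₁²) - (D k^{-p})^{2θ}`; inserted into the descent
this is the nonlinear recursion with power `2θ`. -/
lemma gap_rate_of_KL {G Ψ a : ℕ → ℝ} {K : ℕ} {a₀ b σ D c γ p θ l r : ℝ}
    (hK : 1 ≤ K) (hγ : 0 < γ) (hb : 0 < b) (hσ : 0 ≤ σ) (hD : 0 ≤ D)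
    (ha₀ : 0 < a₀) (hθ : 1 / 2 ≤ θ) (hθ' : θ < 1) (hr : 0 ≤ r) (hrp : r ≤ p)
    (hq : γ + (2 * θ - 1) * r < 1 ∨ γ + (2 * θ - 1) * r = 1 ∧ 1 < 2 * θ)
    (ha : ∀ k : ℕ, 1 ≤ k → a₀ * (k : ℝ) ^ (-γ) ≤ a k)
    (hG : ∀ k, 0 ≤ G k) (hG1 : ∀ k, K ≤ k → G k ≤ 1)
    (hδ : ∀ k, K ≤ k → 0 ≤ meritGap Ψ G l σ D p k ∧
      meritGap Ψ G l σ D p (k + 1) ≤ meritGap Ψ G l σ D p k - b * a k * G k ^ 2)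
    (hkl : ∀ᶠ k in atTop, |Ψ k - l| ^ θ ≤ c * G k) :
    ∃ M : ℝ, 0 < M ∧ ∀ᶠ k : ℕ in atTop, meritGap Ψ G l σ D p k ≤ M * (k : ℝ) ^ (-r) := by
  set C₁ := |c| + σ ^ θ + 1 with hC₁
  have hC₁0 : 0 < C₁ := by positivity
  refine nonlinear_recursion_rate (c := b * a₀ / (2 * C₁ ^ 2)) (C := b * a₀ * D ^ (2 * θ))
    (s := 2 * θ) (γ := γ) (p := p) (by positivity) (by positivity) (by linarith) hγ hr hrp hq
    (eventually_atTop.2 ⟨K, fun k hk => (hδ k hk).1⟩) ?_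
  filter_upwards [hkl, eventually_ge_atTop K] with k hk hkK
  have hkp : (0 : ℝ) < k := by exact_mod_cast hK.trans hkK
  obtain ⟨h1, h2⟩ := hδ k hkK
  have h3 := meritGap_rpow_le hσ hD hθ hθ' (hG k) (hG1 k hkK) h1 hk
  set x := meritGap Ψ G l σ D p k with hx
  set v := (D * (k : ℝ) ^ (-p)) ^ θ with hv
  have hv0 : 0 ≤ v := by positivity
  have h4 : x ^ (2 * θ) ≤ 2 * C₁ ^ 2 * (G k ^ 2 + v ^ 2) := by
    have e1 : x ^ (2 * θ) = (x ^ θ) ^ 2 := by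
      rw [← Real.rpow_natCast, ← Real.rpow_mul h1]; congr 1; push_cast; ring
    rw [e1]
    calc (x ^ θ) ^ 2 ≤ (C₁ * (G k + v)) ^ 2 := by gcongr
      _ ≤ _ := by nlinarith [mul_nonneg (sq_nonneg C₁) (sq_nonneg (G k - v))]
  have h5 : b * (a₀ * (k : ℝ) ^ (-γ)) * G k ^ 2 ≤ b * a k * G k ^ 2 := by
    gcongr; exact ha k (hK.trans hkK)
  have h6 : x ^ (2 * θ) / (2 * C₁ ^ 2) - v ^ 2 ≤ G k ^ 2 := by
    rw [sub_le_iff_le_add, div_le_iff₀ (by positivity)]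
    linarith
  have h7 := mul_le_mul_of_nonneg_left h6 (by positivity : 0 ≤ b * (a₀ * (k : ℝ) ^ (-γ)))
  have h8 : (k : ℝ) ^ (-γ) * v ^ 2 = D ^ (2 * θ) * (k : ℝ) ^ (-(γ + 2 * θ * p)) := by
    rw [hv, ← Real.rpow_natCast, ← Real.rpow_mul (by positivity),
      Real.mul_rpow hD (by positivity), ← Real.rpow_mul hkp.le,
      show -(γ + 2 * θ * p) = -γ + -p * (θ * (2 : ℕ)) by push_cast; ring, Real.rpow_add hkp,
      show θ * ((2 : ℕ) : ℝ) = 2 * θ by push_cast; ring]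
    ring
  have h9 : b * (a₀ * (k : ℝ) ^ (-γ)) * (x ^ (2 * θ) / (2 * C₁ ^ 2) - v ^ 2) =
      b * a₀ / (2 * C₁ ^ 2) * (k : ℝ) ^ (-γ) * x ^ (2 * θ) -
        b * a₀ * ((k : ℝ) ^ (-γ) * v ^ 2) := by ring
  rw [h9, h8] at h7
  linarith

/-- At exponent one half and `γ = 1` the recursion is linear and critical, so constants matter.
Instead of the crude squared bound, `|Ψ - l| ≤ c² G²` gives `δ - D k^{-2} ≤ (c² + σ) G²`, and the
coefficient `b α' / (c² + σ)` must exceed the rate exponent 2. -/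
lemma gap_rate_of_KL_half {G Ψ a : ℕ → ℝ} {K : ℕ} {b σ D c l α' : ℝ}
    (hK : 1 ≤ K) (hb : 0 < b) (hσ : 0 < σ) (hD : 0 ≤ D)
    (hbig : 2 * (c ^ 2 + σ) < b * α')
    (ha : ∀ᶠ k : ℕ in atTop, α' * (k : ℝ) ^ (-1 : ℝ) ≤ a k)
    (hδ : ∀ k, K ≤ k → 0 ≤ meritGap Ψ G l σ D 2 k ∧
      meritGap Ψ G l σ D 2 (k + 1) ≤ meritGap Ψ G l σ D 2 k - b * a k * G k ^ 2)
    (hkl : ∀ᶠ k in atTop, |Ψ k - l| ^ (1 / 2 : ℝ) ≤ c * G k) :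
    ∃ M : ℝ, 0 < M ∧ ∀ᶠ k : ℕ in atTop,
      meritGap Ψ G l σ D 2 k ≤ M * (k : ℝ) ^ (-2 : ℝ) := by
  have hκ : 0 < c ^ 2 + σ := by positivity
  have hα' : 0 < α' := by
    by_contra! h
    nlinarith
  set A := b * α' / (c ^ 2 + σ) with hA
  have hA2 : 2 < A := by rw [hA, lt_div_iff₀ hκ]; exact hbig
  refine linear_recursion_rate (A := A) (B := A * D) (q := 1) (r := 2) (by linarith)
    (by positivity) one_pos le_rfl (by norm_num) (fun _ => hA2) ?_
  filter_upwards [hkl, ha, eventually_ge_atTop K] with k hk hak hkK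
  have hkp : (0 : ℝ) < k := by exact_mod_cast hK.trans hkK
  have h2 := (hδ k hkK).2
  have h3 : |Ψ k - l| ≤ c ^ 2 * G k ^ 2 := by
    calc |Ψ k - l| = (|Ψ k - l| ^ (1 / 2 : ℝ)) ^ 2 := by
          rw [← Real.rpow_natCast, ← Real.rpow_mul (abs_nonneg _)]; norm_num
      _ ≤ (c * G k) ^ 2 := by gcongr
      _ = _ := by ring
  have h4 : (meritGap Ψ G l σ D 2 k - D * (k : ℝ) ^ (-2 : ℝ)) / (c ^ 2 + σ) ≤ G k ^ 2 := by
    rw [div_le_iff₀ hκ]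
    simp only [meritGap]
    linarith [le_abs_self (Ψ k - l)]
  have h5 : b * (α' * (k : ℝ) ^ (-1 : ℝ)) * G k ^ 2 ≤ b * a k * G k ^ 2 := by gcongr
  have h6 := mul_le_mul_of_nonneg_left h4 (by positivity : 0 ≤ b * (α' * (k : ℝ) ^ (-1 : ℝ)))
  have h7 : (k : ℝ) ^ (-(1 + 2) : ℝ) = (k : ℝ) ^ (-1 : ℝ) * (k : ℝ) ^ (-2 : ℝ) := by
    rw [← Real.rpow_add hkp]; norm_num
  have h8 : b * (α' * (k : ℝ) ^ (-1 : ℝ)) *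
      ((meritGap Ψ G l σ D 2 k - D * (k : ℝ) ^ (-2 : ℝ)) / (c ^ 2 + σ)) =
      A * (k : ℝ) ^ (-1 : ℝ) * meritGap Ψ G l σ D 2 k -
        A * D * ((k : ℝ) ^ (-1 : ℝ) * (k : ℝ) ^ (-2 : ℝ)) := by
    rw [hA]; ring
  rw [h7]
  linarith

/-! ### Asymptotics of the step sizes. -/

/-- Step sizes `α / (β + k) ^ γ` are of order `k ^ (-γ)`. -/
lemma stepsize_bounds {α β γ : ℝ} (hα : 0 < α) (hβ : 0 ≤ β) (hγ : 0 < γ) {k : ℕ} (hk : 1 ≤ k) :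
    α / (1 + β) ^ γ * (k : ℝ) ^ (-γ) ≤ α / (β + (k : ℝ)) ^ γ ∧
      α / (β + (k : ℝ)) ^ γ ≤ α * (k : ℝ) ^ (-γ) := by
  have hk1 : (1 : ℝ) ≤ k := by exact_mod_cast hk
  have hkp : (0 : ℝ) < k := by linarith
  have hk0 : (0 : ℝ) < (k : ℝ) ^ γ := by positivity
  rw [Real.rpow_neg hkp.le, ← div_eq_mul_inv, ← div_eq_mul_inv, div_div]
  constructor
  · gcongr
    rw [← Real.mul_rpow (by positivity) hkp.le]
    gcongr
    nlinarith
  · gcongr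
    linarith

/-- The uniform constant `α / (1 + β)` would spoil the threshold on `α` in the critical case;
asymptotically the shift `β` costs arbitrarily little. -/
lemma eventually_stepsize_ge {α α' β : ℝ} (hα : α' < α) (hβ : 0 ≤ β) :
    ∀ᶠ k : ℕ in atTop, α' * (k : ℝ) ^ (-1 : ℝ) ≤ α / (β + (k : ℝ)) ^ (1 : ℝ) := by
  filter_upwards [eventually_ge_atTop 1,
    tendsto_natCast_atTop_atTop.eventually_ge_atTop (α' * β / (α - α'))] with k hk hk2
  have hkp : (0 : ℝ) < k := by exact_mod_cast hk
  rw [div_le_iff₀ (by linarith)] at hk2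
  rw [Real.rpow_neg_one, Real.rpow_one, ← div_eq_mul_inv, div_le_div_iff₀ hkp (by linarith)]
  nlinarith

/-! ### The proximity operator, the descent lemma and the Fréchet sum rule. -/

variable {d n : ℕ}

/-- Because `φ` is bounded below, the quadratic makes the objective coercive, and lower
semicontinuity gives a minimizer on a large ball. Uniqueness is not needed: later arguments use only
the weak subgradient inequality. -/
lemma exists_isMinOn_prox {φ : E d → EReal} {lam : ℝ} (hlam : 0 < lam)
    (hφ_lsc : LowerSemicontinuous φ) (hφ_proper : IsProper φ)
    (hφ_lb : ∃ φlb : ℝ, ∀ x ∈ dom φ, (φlb : EReal) ≤ φ x) (z : E d) :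
    ∃ w, IsMinOn (fun y : E d => φ y + ((1 / (2 * lam) * ‖z - y‖ ^ 2 : ℝ) : EReal))
      Set.univ w := by
  obtain ⟨hbot, x₀, hx₀⟩ := hφ_proper
  obtain ⟨m, hm⟩ := hφ_lb
  have hm' : ∀ y, (m : EReal) ≤ φ y := fun y => by
    by_cases hy : φ y = ⊤
    · rw [hy]; exact le_top
    · exact hm y hy
  set h : E d → EReal := fun y => φ y + ((1 / (2 * lam) * ‖z - y‖ ^ 2 : ℝ) : EReal) with hh
  have hlsc : LowerSemicontinuous h := by
    refine hφ_lsc.add' (Continuous.lowerSemicontinuous ?_) fun x => ?_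
    · exact continuous_coe_real_ereal.comp (by fun_prop)
    · exact EReal.continuousAt_add (Or.inr (EReal.coe_ne_bot _)) (Or.inr (EReal.coe_ne_top _))
  lift φ x₀ to ℝ using ⟨hx₀, hbot x₀⟩ with v hv
  set v₁ := v + 1 / (2 * lam) * ‖z - x₀‖ ^ 2 with hv₁
  have hhx₀ : h x₀ = (v₁ : ℝ) := by
    simp only [hh]
    rw [← hv, hv₁, EReal.coe_add]
  -- The first entry puts `x₀` into the ball. Outside it the quadratic exceeds `v₁ - m`; the summand
  -- 1 lets a bound on the norm serve as one on its square.
  set R := max ‖z - x₀‖ (2 * lam * |v₁ - m| + 1) with hR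
  obtain ⟨w, -, hmin⟩ := LowerSemicontinuousOn.exists_isMinOn (s := Metric.closedBall z R)
    ⟨x₀, by rw [mem_closedBall_iff_norm, norm_sub_rev]; exact le_max_left _ _⟩
    (isCompact_closedBall z R) (hlsc.lowerSemicontinuousOn _)
  refine ⟨w, fun y _ => ?_⟩
  by_cases hy : y ∈ Metric.closedBall z R
  · exact hmin hy
  have h1 : h w ≤ h x₀ := hmin (by
    rw [mem_closedBall_iff_norm, norm_sub_rev]; exact le_max_left _ _)
  refine h1.trans ?_
  rw [hhx₀]
  refine le_trans ?_ (add_le_add_left (hm' y) _)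
  rw [← EReal.coe_add, EReal.coe_le_coe_iff]
  rw [mem_closedBall_iff_norm, norm_sub_rev, not_le] at hy
  have h2 : 2 * lam * |v₁ - m| + 1 ≤ ‖z - y‖ := (le_max_right _ _).trans hy.le
  have h3 : 2 * lam * |v₁ - m| ≤ ‖z - y‖ ^ 2 := by
    have : 0 ≤ 2 * lam * |v₁ - m| := by positivity
    nlinarith
  have h4 : |v₁ - m| ≤ 1 / (2 * lam) * ‖z - y‖ ^ 2 := by
    rw [one_div, ← div_eq_inv_mul, le_div_iff₀ (by positivity)]
    linarith
  linarith [le_abs_self (v₁ - m)]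

lemma isMinOn_prox {φ : E d → EReal} {lam : ℝ} (hlam : 0 < lam)
    (hφ_lsc : LowerSemicontinuous φ) (hφ_proper : IsProper φ)
    (hφ_lb : ∃ φlb : ℝ, ∀ x ∈ dom φ, (φlb : EReal) ≤ φ x) (z : E d) :
    IsMinOn (fun y : E d => φ y + ((1 / (2 * lam) * ‖z - y‖ ^ 2 : ℝ) : EReal)) Set.univ
      (prox lam φ z) :=
  Classical.epsilon_spec (exists_isMinOn_prox hlam hφ_lsc hφ_proper hφ_lb z)

lemma mem_dom_of_isMinOn {φ : E d → EReal} {lam : ℝ} (hφ_proper : IsProper φ) {z w : E d}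
    (hw : IsMinOn (fun y : E d => φ y + ((1 / (2 * lam) * ‖z - y‖ ^ 2 : ℝ) : EReal)) Set.univ w) :
    w ∈ dom φ := by
  obtain ⟨hbot, x₀, hx₀⟩ := hφ_proper
  intro htop
  have h := hw (Set.mem_univ x₀)
  simp only [Set.mem_ofPred_eq, htop, EReal.top_add_coe, top_le_iff] at h
  lift φ x₀ to ℝ using ⟨hx₀, hbot x₀⟩ with v hv
  rw [← EReal.coe_add] at h
  exact EReal.coe_ne_top _ h

/-- Compare `w` with `w + t (y - w)`, use convexity of `φ + (ρ / 2) ‖·‖²`, divide by `t` and let `t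
→ 0`. -/
lemma weak_subgradient_of_isMinOn {φ : E d → EReal} {lam ρ : ℝ} (hlam : 0 < lam)
    (hφ_wc : IsWeaklyConvex ρ φ) (hφ_proper : IsProper φ) {z w : E d}
    (hw : IsMinOn (fun y : E d => φ y + ((1 / (2 * lam) * ‖z - y‖ ^ 2 : ℝ) : EReal)) Set.univ w)
    {y : E d} (hy : y ∈ dom φ) :
    (φ w).toReal + inner ℝ (lam⁻¹ • (z - w)) (y - w) - ρ / 2 * ‖y - w‖ ^ 2 ≤ (φ y).toReal := by
  have hwd := mem_dom_of_isMinOn hφ_proper hw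
  set D := y - w with hD
  have hreal : ∀ x ∈ dom φ, φ x = ((φ x).toReal : EReal) := fun x hx =>
    (EReal.coe_toReal hx (hφ_proper.1 x)).symm
  have key : ∀ t : ℝ, 0 < t → t ≤ 1 → (φ w).toReal - (φ y).toReal +
      inner ℝ (lam⁻¹ • (z - w)) D - ρ / 2 * ‖D‖ ^ 2 ≤ t * (1 / (2 * lam) + |ρ|) * ‖D‖ ^ 2 := by
    intro t ht ht1
    set x := (1 - t) • w + t • y with hx
    have hxw : x = w + t • D := by rw [hx, hD]; module
    have hxd : x ∈ dom φ := hφ_wc.1 hwd hy (by linarith) ht.le (by ring)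
    have hcv := hφ_wc.2 hwd hy (by linarith : 0 ≤ 1 - t) ht.le (by ring)
    simp only [smul_eq_mul] at hcv
    rw [← hx] at hcv
    have hmin := hw (Set.mem_univ x)
    simp only [Set.mem_ofPred_eq] at hmin
    rw [hreal x hxd, hreal w hwd, ← EReal.coe_add, ← EReal.coe_add, EReal.coe_le_coe_iff] at hmin
    have e1 : ‖z - x‖ ^ 2 = ‖z - w‖ ^ 2 - 2 * t * inner ℝ (z - w) D + t ^ 2 * ‖D‖ ^ 2 := by
      rw [hxw, ← sub_sub, norm_sub_sq_real, inner_smul_right, norm_smul, mul_pow,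
        Real.norm_eq_abs, sq_abs]
      ring
    have e2 : ‖x‖ ^ 2 = ‖w‖ ^ 2 + 2 * t * inner ℝ w D + t ^ 2 * ‖D‖ ^ 2 := by
      rw [hxw, norm_add_sq_real, inner_smul_right, norm_smul, mul_pow,
        Real.norm_eq_abs, sq_abs]
      ring
    have e3 : ‖y‖ ^ 2 = ‖w‖ ^ 2 + 2 * inner ℝ w D + ‖D‖ ^ 2 := by
      rw [show y = w + D by rw [hD]; abel, norm_add_sq_real]
    rw [e2, e3] at hcv
    rw [e1] at hmin
    rw [real_inner_smul_left]
    have e4 : 1 / (2 * lam) * (2 * t * inner ℝ (z - w) D) = t * (lam⁻¹ * inner ℝ (z - w) D) := by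
      field_simp
    have e5 : t * ((φ w).toReal - (φ y).toReal + lam⁻¹ * inner ℝ (z - w) D - ρ / 2 * ‖D‖ ^ 2) ≤
        t * (t * (1 / (2 * lam) - ρ / 2) * ‖D‖ ^ 2) := by
      linarith
    have e6 := le_of_mul_le_mul_left e5 ht
    refine e6.trans ?_
    have : -(ρ / 2) ≤ |ρ| := by
      have h1 := neg_abs_le ρ
      have h2 := abs_nonneg ρ
      linarith
    gcongr
    linarith
  have hlim : Tendsto (fun t : ℝ => t * (1 / (2 * lam) + |ρ|) * ‖D‖ ^ 2) (𝓝[>] 0)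
      (𝓝 (0 * (1 / (2 * lam) + |ρ|) * ‖D‖ ^ 2)) :=
    Tendsto.mono_left (Continuous.tendsto (by fun_prop) 0) nhdsWithin_le_nhds
  have := ge_of_tendsto hlim (by
    filter_upwards [Ioc_mem_nhdsGT (zero_lt_one (α := ℝ))] with t ht
    exact key t ht.1 ht.2)
  linarith

/-- Monotonicity inequality for points satisfying the weak subgradient inequality. -/
lemma prox_strong_mono {H : Type*} [NormedAddCommGroup H] [InnerProductSpace ℝ H]
    {lam ρ a b : ℝ} (hlam : 0 < lam) {z z' w w' : H}
    (h : a + inner ℝ (lam⁻¹ • (z - w)) (w' - w) - ρ / 2 * ‖w' - w‖ ^ 2 ≤ b)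
    (h' : b + inner ℝ (lam⁻¹ • (z' - w')) (w - w') - ρ / 2 * ‖w - w'‖ ^ 2 ≤ a) :
    (1 - lam * ρ) * ‖w' - w‖ ^ 2 ≤ inner ℝ (z' - z) (w' - w) := by
  rw [norm_sub_rev w w', ← neg_sub w' w, inner_neg_right] at h'
  have h1 : inner ℝ (lam⁻¹ • (z - w)) (w' - w) - inner ℝ (lam⁻¹ • (z' - w')) (w' - w) =
      lam⁻¹ * (‖w' - w‖ ^ 2 - inner ℝ (z' - z) (w' - w)) := by
    rw [← inner_sub_left, ← smul_sub, real_inner_smul_left, ← real_inner_self_eq_norm_sq,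
      ← inner_sub_left]
    congr 2
    abel
  have h2 : lam⁻¹ * (‖w' - w‖ ^ 2 - inner ℝ (z' - z) (w' - w)) ≤ ρ * ‖w' - w‖ ^ 2 := by
    linarith
  rw [inv_mul_le_iff₀ hlam] at h2
  linarith

lemma norm_le_two_mul_of_strong_mono {H : Type*} [NormedAddCommGroup H] [InnerProductSpace ℝ H]
    {s : ℝ} (hs : 1 / 2 ≤ s) {x y : H} (h : s * ‖x‖ ^ 2 ≤ inner ℝ y x) : ‖x‖ ≤ 2 * ‖y‖ := by
  rcases (norm_nonneg x).eq_or_lt with h0 | h0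
  · rw [← h0]; positivity
  have h1 := real_inner_le_norm y x
  have h2 : 1 / 2 * ‖x‖ ^ 2 ≤ s * ‖x‖ ^ 2 := by gcongr
  have h3 : ‖x‖ * ‖x‖ ≤ (2 * ‖y‖) * ‖x‖ := by nlinarith
  exact le_of_mul_le_mul_right h3 h0

/-- Along the segment, `f` minus its linear and quadratic model has nonpositive derivative. The
gradient is Lipschitz only on `D`, so convexity of `D` is what keeps the segment admissible. -/
lemma le_of_lipschitz_gradient {f : E d → ℝ} (hf : Differentiable ℝ f) {L : ℝ} {D : Set (E d)}
    (hD : Convex ℝ D) (hL : ∀ x ∈ D, ∀ y ∈ D, ‖gradient f x - gradient f y‖ ≤ L * ‖x - y‖)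
    {x y : E d} (hx : x ∈ D) (hy : y ∈ D) :
    f y ≤ f x + inner ℝ (gradient f x) (y - x) + L / 2 * ‖y - x‖ ^ 2 := by
  set v := y - x with hv
  set q : ℝ → ℝ := fun s => f (x + s • v) - s * inner ℝ (gradient f x) v
    - L / 2 * s ^ 2 * ‖v‖ ^ 2 with hq
  have hder : ∀ s : ℝ, HasDerivAt q (inner ℝ (gradient f (x + s • v)) v
      - inner ℝ (gradient f x) v - L * s * ‖v‖ ^ 2) s := by
    intro s
    have h1 : HasDerivAt (fun s : ℝ => x + s • v) v s := by
      simpa using ((hasDerivAt_id s).smul_const v).const_add x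
    have h2 := ((hf (x + s • v)).hasGradientAt.hasFDerivAt.comp_hasDerivAt s h1)
    rw [InnerProductSpace.toDual_apply_apply] at h2
    have h3 := (hasDerivAt_id s).mul_const (inner ℝ (gradient f x) v)
    have h4 := ((((hasDerivAt_id s).pow 2).const_mul (L / 2)).mul_const (‖v‖ ^ 2))
    have h5 := (h2.sub h3).sub h4
    refine HasDerivAt.congr_deriv h5 ?_
    simp only [id_eq, Nat.cast_ofNat, show 2 - 1 = 1 from rfl, pow_one]
    ring
  have hanti : AntitoneOn q (Set.Icc 0 1) := by
    refine antitoneOn_of_deriv_nonpos (convex_Icc 0 1)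
      (fun s _ => (hder s).continuousAt.continuousWithinAt)
      (fun s _ => (hder s).differentiableAt.differentiableWithinAt) fun s hs => ?_
    rw [interior_Icc] at hs
    rw [(hder s).deriv, ← inner_sub_left]
    have hmem : x + s • v ∈ D := by
      have := hD hx hy (by linarith [hs.2] : 0 ≤ 1 - s) hs.1.le (by ring)
      convert this using 1
      rw [hv]; module
    have h1 := hL _ hmem x hx
    rw [add_sub_cancel_left, norm_smul, Real.norm_eq_abs, abs_of_pos hs.1] at h1
    have h2 := real_inner_le_norm (gradient f (x + s • v) - gradient f x) v
    have h3 := mul_le_mul_of_nonneg_right h1 (norm_nonneg v)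
    nlinarith
  have h := hanti (Set.left_mem_Icc.2 zero_le_one) (Set.right_mem_Icc.2 zero_le_one) zero_le_one
  simp only [hq, one_smul, zero_smul, add_zero] at h
  rw [show x + v = y by rw [hv]; abel] at h
  linarith

lemma hasGradientAt_smoothPart {f : Fin n → E d → ℝ} (hf : ∀ i, Differentiable ℝ (f i)) (x : E d) :
    HasGradientAt (smoothPart f) ((1 / (n : ℝ)) • ∑ i, gradient (f i) x) x := by
  rw [hasGradientAt_iff_hasFDerivAt, map_smul, map_sum]
  have h := (HasFDerivAt.fun_sum (u := Finset.univ) fun i _ =>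
    ((hf i x).hasGradientAt.hasFDerivAt)).const_mul (1 / (n : ℝ))
  exact h

lemma norm_gradient_smoothPart_sub_le (hn : 0 < n) {f : Fin n → E d → ℝ}
    (hf : ∀ i, Differentiable ℝ (f i)) {L : ℝ} {D : Set (E d)}
    (hL : ∀ i, ∀ x ∈ D, ∀ y ∈ D, ‖gradient (f i) x - gradient (f i) y‖ ≤ L * ‖x - y‖)
    {x y : E d} (hx : x ∈ D) (hy : y ∈ D) :
    ‖gradient (smoothPart f) x - gradient (smoothPart f) y‖ ≤ L * ‖x - y‖ := by
  rw [(hasGradientAt_smoothPart hf x).gradient, (hasGradientAt_smoothPart hf y).gradient,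
    ← smul_sub, ← Finset.sum_sub_distrib, norm_smul]
  have hn' : (0 : ℝ) < n := by exact_mod_cast hn
  have h := norm_sum_le_of_le Finset.univ fun i _ => hL i x hx y hy
  rw [Finset.sum_const, Finset.card_univ, Fintype.card_fin, nsmul_eq_mul] at h
  rw [Real.norm_eq_abs, abs_of_pos (by positivity), one_div, ← div_eq_inv_mul,
    div_le_iff₀ hn']
  linarith

/-- Fréchet sum rule for a differentiable and a weakly convex function. -/
lemma mem_frechetSubdiff_obj {f : Fin n → E d → ℝ} {φ : E d → EReal} {ρ : ℝ} {w u : E d}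
    (hf : Differentiable ℝ (smoothPart f)) (hφ_bot : ∀ x, φ x ≠ ⊥) (hw : w ∈ dom φ)
    (hu : ∀ y ∈ dom φ, (φ w).toReal + inner ℝ u (y - w) - ρ / 2 * ‖y - w‖ ^ 2 ≤ (φ y).toReal) :
    gradient (smoothPart f) w + u ∈ frechetSubdiff (obj f φ) w := by
  have hreal : ∀ x ∈ dom φ, φ x = ((φ x).toReal : EReal) := fun x hx =>
    (EReal.coe_toReal hx (hφ_bot x)).symm
  have hobj : ∀ x ∈ dom φ, obj f φ x = ((smoothPart f x + (φ x).toReal : ℝ) : EReal) := by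
    intro x hx
    rw [obj, hreal x hx, EReal.toReal_coe, EReal.coe_add]
  refine ⟨by rw [hobj w hw]; exact EReal.coe_ne_top _,
    by rw [hobj w hw]; exact EReal.coe_ne_bot _, fun ε hε => ?_⟩
  have h1 := (hasGradientAt_iff_isLittleO.1 (hf w).hasGradientAt).def (half_pos hε)
  -- The quadratic defect of the weak subgradient inequality is `o(‖y - w‖)`; it takes half of `ε`,
  -- the remainder of the smooth part the other half.
  have h2 : Tendsto (fun y : E d => |ρ| / 2 * ‖y - w‖) (𝓝 w) (𝓝 (|ρ| / 2 * ‖w - w‖)) :=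
    Continuous.tendsto (by fun_prop) w
  rw [sub_self, norm_zero, mul_zero] at h2
  filter_upwards [h1, h2.eventually_le_const (half_pos hε)] with y hy1 hy2
  by_cases hy : y ∈ dom φ
  · rw [hobj w hw, hobj y hy, ← EReal.coe_add, EReal.coe_le_coe_iff, inner_add_left]
    have h3 := hu y hy
    rw [Real.norm_eq_abs] at hy1
    have h4 := (abs_le.1 hy1).1
    have h5 : ρ / 2 * ‖y - w‖ ^ 2 ≤ ε / 2 * ‖y - w‖ := by
      have h6 : ρ / 2 * ‖y - w‖ ≤ |ρ| / 2 * ‖y - w‖ := by gcongr; exact le_abs_self ρ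
      have h7 := mul_le_mul_of_nonneg_right (h6.trans hy2) (norm_nonneg (y - w))
      linarith
    linarith
  · have : φ y = ⊤ := not_not.1 hy
    rw [obj, obj, this, EReal.coe_add_top]
    exact le_top

/-! ### One-step descent of the merit function. -/

/-- First- and second-order terms in the expansion of the merit function. -/
lemma merit_terms_le {lam ρ L τ' t s m G W Z N X gw gv ge zw ew : ℝ} (hlam : 0 < lam)
    (hL : 0 < L) (hρ : 0 ≤ ρ) (hτ' : 0 < τ') (hτ2 : τ' ≤ 1 / 2) (ht : 0 < t)
    (hm : m = lam ^ 2 * L ^ 2) (hslack : τ' * m / 2 + 1 / 4 ≤ (1 - τ') * (1 - s))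
    (hW0 : 0 ≤ W) (hZ0 : 0 ≤ Z) (hN0 : 0 ≤ N) (hX0 : 0 ≤ X)
    (hw2 : W ≤ 2 * Z) (hxn : X ≤ (2 * lam * L + 3) * Z) (hZG : Z ≤ t * G + N)
    (hmono : (1 - s) * W ^ 2 ≤ zw) (hzw : zw = -(t * gw) + ew) (hew : ew ≤ N * W)
    (hgv : gv ≤ G * (L * W)) (hge : ge ≤ G * N) (hzw' : zw ≤ Z * W) :
    gw + lam⁻¹ * zw + ((L + ρ) / 2 - lam⁻¹) * W ^ 2 +
      (τ' * (lam * gv + (-(t * G ^ 2) + ge) - gw) + τ' / (2 * lam) * X ^ 2) ≤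
      -(3 / 8 * τ' * t * G ^ 2) +
      ((2 * lam * L + 3) ^ 2 / (4 * lam) + 2 / lam + 2 * (L + ρ)) *
        (2 * t ^ 2 * G ^ 2 + 2 * N ^ 2) + 3 * N ^ 2 / t := by
  -- `G, W, Z, N, X` are the norms of `g, Δw, Δz, e` and of `lam • v + Δz - Δw`; the two-letter
  -- variables are inner products. Strong monotonicity of prox makes `gw` negative of order `W² /
  -- t`. By `hslack` this pays for the `W² / t` term in `b3`, the extra 1/4 covering `N W`. Of the
  -- decrease `τ' t G²`, `b3` spends 1/2 and `b4` spends 1/8, leaving 3/8.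
  have b1 : gw ≤ (N * W - (1 - s) * W ^ 2) / t := by
    rw [le_div_iff₀ ht]
    linarith
  have b2 : (1 - τ') * gw ≤ N ^ 2 / t - (τ' * m / 2) * W ^ 2 / t := by
    have h1 := mul_le_mul_of_nonneg_left b1 (by linarith : 0 ≤ 1 - τ')
    refine h1.trans ?_
    rw [← sub_div, ← mul_div_assoc]
    gcongr
    have h2 : (1 - τ') * (N * W) ≤ N * W := by
      have : 0 ≤ N * W := by positivity
      nlinarith
    have h3 := mul_le_mul_of_nonneg_right hslack (sq_nonneg W)
    linarith [sq_nonneg (N - W / 2)]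
  have b3 : τ' * (lam * gv) ≤ τ' * t * G ^ 2 / 2 + (τ' * m / 2) * W ^ 2 / t := by
    have h2 : τ' * (lam * gv) ≤ τ' * (lam * (G * (L * W))) := by gcongr
    have h3 : τ' * (lam * (G * (L * W))) * t ≤
        (τ' * t * G ^ 2 / 2) * t + (τ' * m / 2) * W ^ 2 := by
      rw [hm]
      linarith [mul_nonneg hτ'.le (sq_nonneg (t * G - lam * L * W))]
    have h4 : τ' * (lam * (G * (L * W))) ≤
        ((τ' * t * G ^ 2 / 2) * t + (τ' * m / 2) * W ^ 2) / t := by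
      rw [le_div_iff₀ ht]; exact h3
    rw [add_div, mul_div_cancel_right₀ _ ht.ne'] at h4
    exact h2.trans h4
  have b4 : τ' * ge ≤ τ' * t * G ^ 2 / 8 + 2 * N ^ 2 / t := by
    have h1 : τ' * ge ≤ τ' * (G * N) := by
      gcongr
    have h2 : τ' * (G * N) * t ≤ (τ' * t * G ^ 2 / 8) * t + 2 * N ^ 2 := by
      linarith [mul_nonneg hτ'.le (sq_nonneg (t * G - 4 * N)),
        mul_le_mul_of_nonneg_right hτ2 (sq_nonneg N), sq_nonneg N]
    have h4 : τ' * (G * N) ≤ ((τ' * t * G ^ 2 / 8) * t + 2 * N ^ 2) / t := by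
      rw [le_div_iff₀ ht]; exact h2
    rw [add_div, mul_div_cancel_right₀ _ ht.ne'] at h4
    exact h1.trans h4
  have hZ2 : Z ^ 2 ≤ 2 * t ^ 2 * G ^ 2 + 2 * N ^ 2 := by
    have h2 : Z ^ 2 ≤ (t * G + N) ^ 2 := by gcongr
    linarith [sq_nonneg (t * G - N)]
  have c1 : τ' / (2 * lam) * X ^ 2 ≤ (2 * lam * L + 3) ^ 2 / (4 * lam) * Z ^ 2 := by
    have h1 : X ^ 2 ≤ ((2 * lam * L + 3) * Z) ^ 2 := by gcongr
    have h2 : τ' / (2 * lam) ≤ 1 / (4 * lam) := by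
      rw [div_le_div_iff₀ (by positivity) (by positivity)]
      nlinarith
    calc τ' / (2 * lam) * X ^ 2 ≤ 1 / (4 * lam) * ((2 * lam * L + 3) * Z) ^ 2 := by gcongr
      _ = _ := by ring
  have c2 : lam⁻¹ * zw ≤ 2 / lam * Z ^ 2 := by
    have h1 : zw ≤ Z * (2 * Z) := hzw'.trans (by gcongr)
    calc lam⁻¹ * zw ≤ lam⁻¹ * (Z * (2 * Z)) := by gcongr
      _ = _ := by ring
  have hW2 : W ^ 2 ≤ 4 * Z ^ 2 := by
    calc W ^ 2 ≤ (2 * Z) ^ 2 := by gcongr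
      _ = _ := by ring
  have c3 : ((L + ρ) / 2 - lam⁻¹) * W ^ 2 ≤ 2 * (L + ρ) * Z ^ 2 := by
    have h1 : 0 ≤ lam⁻¹ * W ^ 2 := by positivity
    have h2 := mul_le_mul_of_nonneg_left hW2 (by positivity : 0 ≤ (L + ρ) / 2)
    linarith
  have hC : 0 ≤ (2 * lam * L + 3) ^ 2 / (4 * lam) + 2 / lam + 2 * (L + ρ) := by positivity
  have c4 := mul_le_mul_of_nonneg_left hZ2 hC
  have e1 : 3 * N ^ 2 / t = N ^ 2 / t + 2 * N ^ 2 / t := by ring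
  have e2 : (1 - τ') * gw = gw - τ' * gw := by ring
  have e3 : 0 ≤ τ' * t * G ^ 2 := by positivity
  rw [e1]
  linarith

/-- One-step decrease of the merit function `ψ + σ' ‖g‖²`, with `σ' = τ' lam / 2`, along a step
`-t g + e`. -/
lemma merit_descent {H : Type*} [NormedAddCommGroup H] [InnerProductSpace ℝ H]
    {lam ρ L τ' t Δψ : ℝ} {g g' Δz Δw v e : H} (hlam : 0 < lam) (hL : 0 < L) (hρ : 0 ≤ ρ)
    (hlamρ : 4 * ρ * lam < 1) (hτ' : 0 < τ') (hτ : τ' ≤ tau lam ρ L) (ht : 0 < t)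
    (hg' : lam • g' = lam • g + (lam • v + Δz - Δw)) (hΔz : Δz = -(t • g) + e)
    (hv : ‖v‖ ≤ L * ‖Δw‖) (hmono : (1 - lam * ρ) * ‖Δw‖ ^ 2 ≤ inner ℝ Δz Δw)
    (hψ : Δψ ≤ inner ℝ g Δw + lam⁻¹ * inner ℝ Δz Δw + ((L + ρ) / 2 - lam⁻¹) * ‖Δw‖ ^ 2) :
    Δψ + τ' * lam / 2 * (‖g'‖ ^ 2 - ‖g‖ ^ 2) ≤ -(3 / 8 * τ' * t * ‖g‖ ^ 2) +
      ((2 * lam * L + 3) ^ 2 / (4 * lam) + 2 / lam + 2 * (L + ρ)) *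
        (2 * t ^ 2 * ‖g‖ ^ 2 + 2 * ‖e‖ ^ 2) + 3 * ‖e‖ ^ 2 / t := by
  set s := lam * ρ with hs
  set m := lam ^ 2 * L ^ 2 with hm
  have hs0 : 0 ≤ s := by positivity
  have hs1 : s < 1 / 4 := by rw [hs]; linarith
  have hm0 : 0 < m := by positivity
  have hden : 0 < 1 - 2 * s + m := by linarith
  have hτm : τ' * (2 * (1 - 2 * s + m)) ≤ 1 - 4 * s := by
    rw [tau, le_div_iff₀ (by rw [hm, hs] at hden; linarith)] at hτ
    rw [hs, hm]
    linarith
  have hτm0 : 0 < τ' * m := by positivity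
  have hτ2 : τ' ≤ 1 / 2 := by nlinarith
  -- The definition of `tau` enters here: a quarter of `hτm` plus half of `hτ2` suffices.
  have hslack : τ' * m / 2 + 1 / 4 ≤ (1 - τ') * (1 - s) := by nlinarith
  have hw2 : ‖Δw‖ ≤ 2 * ‖Δz‖ := norm_le_two_mul_of_strong_mono (by linarith) hmono
  set x := lam • v + Δz - Δw with hx
  have hxn : ‖x‖ ≤ (2 * lam * L + 3) * ‖Δz‖ := by
    have h1 : ‖x‖ ≤ ‖lam • v‖ + ‖Δz‖ + ‖Δw‖ := (norm_sub_le _ _).trans (by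
      gcongr; exact norm_add_le _ _)
    rw [norm_smul, Real.norm_eq_abs, abs_of_pos hlam] at h1
    have h2 : lam * ‖v‖ ≤ lam * (L * (2 * ‖Δz‖)) := by
      gcongr; exact hv.trans (by gcongr)
    linarith
  have hgg : τ' * lam / 2 * (‖g'‖ ^ 2 - ‖g‖ ^ 2) =
      τ' * inner ℝ g x + τ' / (2 * lam) * ‖x‖ ^ 2 := by
    have h1 : lam ^ 2 * ‖g'‖ ^ 2 = lam ^ 2 * ‖g‖ ^ 2 + 2 * (lam * inner ℝ g x) + ‖x‖ ^ 2 := by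
      rw [← mul_pow, ← mul_pow]
      have := congrArg (fun y => ‖y‖ ^ 2) hg'
      simp only [norm_add_sq_real, norm_smul, Real.norm_eq_abs, abs_of_pos hlam,
        real_inner_smul_left] at this
      exact this
    field_simp
    linarith
  have hgx : inner ℝ g x = lam * inner ℝ g v + inner ℝ g Δz - inner ℝ g Δw := by
    rw [hx, inner_sub_right, inner_add_right, inner_smul_right]
  have hgz : inner ℝ g Δz = -(t * ‖g‖ ^ 2) + inner ℝ g e := by
    rw [hΔz, inner_add_right, inner_neg_right, inner_smul_right, real_inner_self_eq_norm_sq]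
  have hzw : inner ℝ Δz Δw = -(t * inner ℝ g Δw) + inner ℝ e Δw := by
    rw [hΔz, inner_add_left, inner_neg_left, real_inner_smul_left]
  have hZG : ‖Δz‖ ≤ t * ‖g‖ + ‖e‖ := by
    rw [hΔz]
    refine (norm_add_le _ _).trans (le_of_eq ?_)
    rw [norm_neg, norm_smul, Real.norm_eq_abs, abs_of_pos ht]
  have hgv : inner ℝ g v ≤ ‖g‖ * (L * ‖Δw‖) := (real_inner_le_norm g v).trans (by gcongr)
  have key := merit_terms_le hlam hL hρ hτ' hτ2 ht hm hslack (norm_nonneg Δw)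
    (norm_nonneg Δz) (norm_nonneg e) (norm_nonneg x) hw2 hxn hZG hmono hzw
    (real_inner_le_norm e Δw) hgv (real_inner_le_norm g e) (real_inner_le_norm Δz Δw)
  rw [hgg, hgx, hgz]
  linarith only [key, hψ]

/-! ### The normal map and its relation to the objective. -/

/-- The standing assumptions on the problem, with the properties of the proximity operator that
they entail. -/
structure Regular (f : Fin n → E d → ℝ) (φ : E d → EReal) (L ρ lam : ℝ) : Prop where
  pos_n : 0 < n
  diff : ∀ i, Differentiable ℝ (f i)
  pos_L : 0 < L
  lip : ∀ i, ∀ x ∈ dom φ, ∀ y ∈ dom φ, ‖gradient (f i) x - gradient (f i) y‖ ≤ L * ‖x - y‖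
  nonneg_ρ : 0 ≤ ρ
  pos_lam : 0 < lam
  lamρ : 4 * ρ * lam < 1
  ne_bot : ∀ x, φ x ≠ ⊥
  convex : Convex ℝ (dom φ)
  lsc : LowerSemicontinuous φ
  prox_mem : ∀ z, prox lam φ z ∈ dom φ
  sub : ∀ z, ∀ y ∈ dom φ, (φ (prox lam φ z)).toReal +
    inner ℝ (lam⁻¹ • (z - prox lam φ z)) (y - prox lam φ z) -
      ρ / 2 * ‖y - prox lam φ z‖ ^ 2 ≤ (φ y).toReal

/-- The real-valued objective, meaningful on the domain. -/
noncomputable def objReal (f : Fin n → E d → ℝ) (φ : E d → EReal) (w : E d) : ℝ :=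
  smoothPart f w + (φ w).toReal

/-- The normal map. -/
noncomputable def normalMap (f : Fin n → E d → ℝ) (φ : E d → EReal) (lam : ℝ) (z : E d) : E d :=
  gradient (smoothPart f) (prox lam φ z) + lam⁻¹ • (z - prox lam φ z)

namespace Regular

variable {f : Fin n → E d → ℝ} {φ : E d → EReal} {L ρ lam : ℝ}

lemma diff_smooth (h : Regular f φ L ρ lam) : Differentiable ℝ (smoothPart f) := fun x =>
  (hasGradientAt_smoothPart h.diff x).differentiableAt

lemma lip_smooth (h : Regular f φ L ρ lam) {x y : E d} (hx : x ∈ dom φ) (hy : y ∈ dom φ) :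
    ‖gradient (smoothPart f) x - gradient (smoothPart f) y‖ ≤ L * ‖x - y‖ :=
  norm_gradient_smoothPart_sub_le h.pos_n h.diff h.lip hx hy

lemma obj_eq (h : Regular f φ L ρ lam) {w : E d} (hw : w ∈ dom φ) :
    obj f φ w = (objReal f φ w : EReal) := by
  rw [obj, objReal, EReal.coe_add, EReal.coe_toReal hw (h.ne_bot w)]

lemma prox_mono (h : Regular f φ L ρ lam) (z z' : E d) :
    (1 - lam * ρ) * ‖prox lam φ z' - prox lam φ z‖ ^ 2 ≤
      inner ℝ (z' - z) (prox lam φ z' - prox lam φ z) :=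
  prox_strong_mono h.pos_lam (h.sub z _ (h.prox_mem z')) (h.sub z' _ (h.prox_mem z))

lemma prox_lip (h : Regular f φ L ρ lam) (z z' : E d) :
    ‖prox lam φ z' - prox lam φ z‖ ≤ 2 * ‖z' - z‖ :=
  norm_le_two_mul_of_strong_mono (by linarith [h.lamρ]) (h.prox_mono z z')

lemma normalMap_lip (h : Regular f φ L ρ lam) (z z' : E d) :
    ‖normalMap f φ lam z' - normalMap f φ lam z‖ ≤ (2 * L + 3 * lam⁻¹) * ‖z' - z‖ := by
  have h1 := h.lip_smooth (h.prox_mem z') (h.prox_mem z)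
  have h2 := h.prox_lip z z'
  have hl : 0 < lam⁻¹ := inv_pos.2 h.pos_lam
  have hL := h.pos_L
  have e : normalMap f φ lam z' - normalMap f φ lam z =
      (gradient (smoothPart f) (prox lam φ z') - gradient (smoothPart f) (prox lam φ z)) +
        lam⁻¹ • ((z' - z) - (prox lam φ z' - prox lam φ z)) := by
    simp only [normalMap]; module
  rw [e]
  refine (norm_add_le _ _).trans ?_
  rw [norm_smul, Real.norm_eq_abs, abs_of_pos hl]
  have h3 := norm_sub_le (z' - z) (prox lam φ z' - prox lam φ z)
  have h4 := mul_le_mul_of_nonneg_left (h3.trans (add_le_add_right h2 _)) hl.le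
  have h5 := mul_le_mul_of_nonneg_left h2 hL.le
  linarith

/-- `λ⁻¹ (z - prox z)` is a weak subgradient of `φ` at `prox z`. Hence the norm of the normal map
bounds the stationarity measure, and KL inequalities can be stated with it. -/
lemma normalMap_mem (h : Regular f φ L ρ lam) (z : E d) :
    normalMap f φ lam z ∈ frechetSubdiff (obj f φ) (prox lam φ z) :=
  mem_frechetSubdiff_obj h.diff_smooth h.ne_bot (h.prox_mem z) (h.sub z)

lemma stat_le (h : Regular f φ L ρ lam) (z : E d) :
    stat (obj f φ) (prox lam φ z) ≤ ENNReal.ofReal ‖normalMap f φ lam z‖ := by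
  refine (Metric.infEDist_le_edist_of_mem (h.normalMap_mem z)).trans (le_of_eq ?_)
  rw [edist_dist, dist_zero_left]

/-- The objective difference is controlled by the descent lemma at the old point and the weak
subgradient inequality at the new one; rewriting the new subgradient through the old normal map
gives the input of `merit_descent`. -/
lemma merit_step (h : Regular f φ L ρ lam) {τ' t : ℝ} {z z' e : E d} (hτ' : 0 < τ')
    (hτ : τ' ≤ tau lam ρ L) (ht : 0 < t) (hz : z' - z = -(t • normalMap f φ lam z) + e) :
    objReal f φ (prox lam φ z') + τ' * lam / 2 * ‖normalMap f φ lam z'‖ ^ 2 ≤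
      objReal f φ (prox lam φ z) + τ' * lam / 2 * ‖normalMap f φ lam z‖ ^ 2
      - 3 / 8 * τ' * t * ‖normalMap f φ lam z‖ ^ 2 +
      ((2 * lam * L + 3) ^ 2 / (4 * lam) + 2 / lam + 2 * (L + ρ)) *
        (2 * t ^ 2 * ‖normalMap f φ lam z‖ ^ 2 + 2 * ‖e‖ ^ 2) + 3 * ‖e‖ ^ 2 / t := by
  set w := prox lam φ z with hw
  set w' := prox lam φ z' with hw'
  have h1 := le_of_lipschitz_gradient h.diff_smooth h.convex
    (fun x hx y hy => h.lip_smooth hx hy) (h.prox_mem z) (h.prox_mem z')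
  have h2 := h.sub z' w (h.prox_mem z)
  have hψ : objReal f φ w' - objReal f φ w ≤ inner ℝ (normalMap f φ lam z) (w' - w) +
      lam⁻¹ * inner ℝ (z' - z) (w' - w) + ((L + ρ) / 2 - lam⁻¹) * ‖w' - w‖ ^ 2 := by
    rw [← hw, ← hw'] at h1
    rw [← hw', norm_sub_rev w w', ← neg_sub w' w, inner_neg_right] at h2
    have e1 : inner ℝ (lam⁻¹ • (z' - w')) (w' - w) =
        inner ℝ (lam⁻¹ • (z - w)) (w' - w) + lam⁻¹ * inner ℝ (z' - z) (w' - w) -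
          lam⁻¹ * ‖w' - w‖ ^ 2 := by
      rw [← real_inner_self_eq_norm_sq, ← real_inner_smul_left, ← real_inner_smul_left,
        ← inner_add_left, ← inner_sub_left]
      congr 1
      module
    rw [e1] at h2
    simp only [objReal, normalMap, inner_add_left, ← hw]
    linarith
  have key := merit_descent (v := gradient (smoothPart f) w' - gradient (smoothPart f) w)
    (g' := normalMap f φ lam z') h.pos_lam h.pos_L h.nonneg_ρ h.lamρ hτ' hτ ht ?_ hz
    (h.lip_smooth (h.prox_mem z') (h.prox_mem z)) (h.prox_mono z z') hψ
  · linarith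
  · simp only [normalMap, ← hw, ← hw', smul_add, smul_sub, smul_inv_smul₀ h.pos_lam.ne']
    abel

/-- Accumulation points of proximal points along which the normal map vanishes are critical. -/
lemma mem_crit_of_tendsto (h : Regular f φ L ρ lam) {z : ℕ → E d} {wbar : E d} {l : ℝ}
    (hw : Tendsto (fun j => prox lam φ (z j)) atTop (𝓝 wbar))
    (hg : Tendsto (fun j => normalMap f φ lam (z j)) atTop (𝓝 0))
    (hl : Tendsto (fun j => objReal f φ (prox lam φ (z j))) atTop (𝓝 l)) :
    wbar ∈ dom φ ∧ 0 ∈ frechetSubdiff (obj f φ) wbar ∧ objReal f φ wbar = l := by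
  set F := smoothPart f with hF
  have hFc : Tendsto (fun j => F (prox lam φ (z j))) atTop (𝓝 (F wbar)) :=
    (h.diff_smooth.continuous.tendsto wbar).comp hw
  have hφl : Tendsto (fun j => (φ (prox lam φ (z j))).toReal) atTop (𝓝 (l - F wbar)) :=
    (hl.sub hFc).congr fun j => by simp only [objReal, ← hF]; ring
  -- Lower semicontinuity bounds `φ wbar` by the limit of the values, which also puts `wbar` into
  -- the domain.
  have hub : ∀ ε : ℝ, 0 < ε → φ wbar ≤ ((l - F wbar + ε : ℝ) : EReal) := by
    intro ε hε
    refine (h.lsc.isClosed_preimage ((l - F wbar + ε : ℝ) : EReal)).mem_of_tendsto hw ?_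
    filter_upwards [hφl.eventually_le_const (show l - F wbar < l - F wbar + ε by linarith)]
      with j hj
    rw [Set.mem_preimage, Set.mem_Iic, ← EReal.coe_toReal (h.prox_mem (z j)) (h.ne_bot _),
      EReal.coe_le_coe_iff]
    exact hj
  have hmem : wbar ∈ dom φ := fun htop => by
    have := hub 1 one_pos
    rw [htop, top_le_iff] at this
    exact EReal.coe_ne_top _ this
  have hgrad : Tendsto (fun j => gradient F (prox lam φ (z j))) atTop (𝓝 (gradient F wbar)) := by
    rw [tendsto_iff_norm_sub_tendsto_zero] at hw ⊢
    refine squeeze_zero (fun _ => norm_nonneg _)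
      (fun j => h.lip_smooth (h.prox_mem (z j)) hmem) ?_
    simpa using hw.const_mul L
  -- Since `z = w + λ (F(z) - ∇f(w))`, the points `z j` converge as well; by continuity of prox,
  -- `wbar = prox zbar`, with vanishing normal map.
  set zbar := wbar + lam • (0 - gradient F wbar) with hzbar
  have hz : Tendsto z atTop (𝓝 zbar) := by
    refine (hw.add ((hg.sub hgrad).const_smul lam)).congr fun j => ?_
    simp only [normalMap, ← hF, add_sub_cancel_left, smul_inv_smul₀ h.pos_lam.ne']
    abel
  have hprox : prox lam φ zbar = wbar := by
    refine tendsto_nhds_unique ?_ hw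
    rw [tendsto_iff_norm_sub_tendsto_zero] at hz ⊢
    refine squeeze_zero (fun _ => norm_nonneg _) (fun j => h.prox_lip zbar (z j)) ?_
    simpa using hz.const_mul 2
  have hnm : normalMap f φ lam zbar = 0 := by
    rw [normalMap, hprox, hzbar, ← hF, add_sub_cancel_left, inv_smul_smul₀ h.pos_lam.ne']
    abel
  refine ⟨hmem, ?_, le_antisymm ?_ ?_⟩
  · have := h.normalMap_mem zbar
    rwa [hnm, hprox] at this
  · refine le_of_forall_pos_le_add fun ε hε => ?_
    have := hub ε hε
    rw [← EReal.coe_toReal hmem (h.ne_bot _), EReal.coe_le_coe_iff] at this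
    rw [objReal, ← hF]
    linarith
  -- The reverse inequality tests the weak subgradient inequality at `z j` with `wbar`; the
  -- subgradients converge, so only function values survive in the limit.
  · have h1 : Tendsto (fun j => (φ (prox lam φ (z j))).toReal +
        inner ℝ (lam⁻¹ • (z j - prox lam φ (z j))) (wbar - prox lam φ (z j)) -
          ρ / 2 * ‖wbar - prox lam φ (z j)‖ ^ 2) atTop
        (𝓝 (l - F wbar + inner ℝ (lam⁻¹ • (zbar - wbar)) (wbar - wbar) -
          ρ / 2 * ‖wbar - wbar‖ ^ 2)) :=
      (hφl.add (((hz.sub hw).const_smul lam⁻¹).inner (hw.const_sub wbar))).sub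
        (((hw.const_sub wbar).norm.pow 2).const_mul (ρ / 2))
    have h2 := le_of_tendsto' h1 fun j => h.sub (z j) wbar hmem
    rw [sub_self, inner_zero_right, norm_zero] at h2
    rw [objReal, ← hF]
    linarith

end Regular

/-! ### An epoch as a perturbed normal map step. -/

/-- Drift of the inner iterates of an epoch. -/
lemma inner_drift_le {H : Type*} [NormedAddCommGroup H] [NormedSpace ℝ H] {a A₀ L lam M : ℝ}
    {h : Fin n → H → H} {zs ws : Fin (n + 1) → H} (ha : 0 ≤ a) (haA : a ≤ A₀) (hL : 0 ≤ L)
    (hlam : 0 < lam) (hM : 0 ≤ M)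
    (hstep : ∀ i : Fin n, zs i.succ = zs i.castSucc -
      a • (h i (ws i.castSucc) + lam⁻¹ • (zs i.castSucc - ws i.castSucc)))
    (hws : ∀ i, ‖ws i - ws 0‖ ≤ 2 * ‖zs i - zs 0‖)
    (hLip : ∀ i j, ‖h i (ws j) - h i (ws 0)‖ ≤ L * ‖ws j - ws 0‖)
    (hbd : ∀ i, ‖h i (ws 0) + lam⁻¹ • (zs 0 - ws 0)‖ ≤ M) (i : Fin (n + 1)) :
    ‖zs i - zs 0‖ ≤ n * a * M * (1 + A₀ * (2 * L + 3 * lam⁻¹)) ^ n := by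
  set q := 1 + A₀ * (2 * L + 3 * lam⁻¹) with hq
  have hC : 0 ≤ 2 * L + 3 * lam⁻¹ := by positivity
  have hA₀ : 0 ≤ A₀ := ha.trans haA
  have hq1 : 1 ≤ q := by
    have : 0 ≤ A₀ * (2 * L + 3 * lam⁻¹) := by positivity
    linarith
  -- The drifts satisfy `r_{i+1} ≤ q r_i + a M`; the bound depends on `i` so that induction closes.
  have key : ‖zs i - zs 0‖ ≤ (i : ℕ) * a * M * q ^ (i : ℕ) := by
    induction i using Fin.induction with
    | zero => simp
    | succ i ih =>
      have e : zs i.succ - zs 0 = (zs i.castSucc - zs 0) -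
          a • ((h i (ws i.castSucc) - h i (ws 0)) +
            lam⁻¹ • ((zs i.castSucc - zs 0) - (ws i.castSucc - ws 0)) +
            (h i (ws 0) + lam⁻¹ • (zs 0 - ws 0))) := by
        rw [hstep]; module
      have hl : 0 < lam⁻¹ := inv_pos.2 hlam
      set r := ‖zs i.castSucc - zs 0‖ with hr
      have h1 := hws i.castSucc
      have h2 : ‖zs i.succ - zs 0‖ ≤ r + a * ((2 * L + 3 * lam⁻¹) * r + M) := by
        rw [e]
        refine (norm_sub_le _ _).trans ?_
        rw [norm_smul, Real.norm_eq_abs, abs_of_nonneg ha]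
        gcongr
        refine (norm_add₃_le).trans ?_
        rw [norm_smul, Real.norm_eq_abs, abs_of_pos hl]
        have h3 := (hLip i i.castSucc).trans (mul_le_mul_of_nonneg_left h1 hL)
        have h4 := mul_le_mul_of_nonneg_left
          ((norm_sub_le (zs i.castSucc - zs 0) (ws i.castSucc - ws 0)).trans
            (add_le_add_right h1 _)) hl.le
        have h5 := hbd i
        linarith
      have hr0 : 0 ≤ r := norm_nonneg _
      have h6 : a * ((2 * L + 3 * lam⁻¹) * r) ≤ A₀ * ((2 * L + 3 * lam⁻¹) * r) := by gcongr
      have h7 : ‖zs i.succ - zs 0‖ ≤ q * r + a * M := by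
        rw [hq]; linarith
      have h8 : q * r ≤ q * ((i : ℕ) * a * M * q ^ (i : ℕ)) := by
        gcongr
        exact ih
      have h9 : a * M * 1 ≤ a * M * q ^ ((i : ℕ) + 1) := by
        gcongr
        exact one_le_pow₀ hq1
      rw [Fin.val_succ]
      push_cast
      rw [pow_succ] at h9 ⊢
      linarith
  refine key.trans ?_
  have h1 : (i : ℕ) ≤ n := Nat.lt_succ_iff.1 i.2
  gcongr

lemma sum_fin_sub {H : Type*} [AddCommGroup H] (m : ℕ) (zs : Fin (m + 1) → H) :
    ∑ i : Fin m, (zs i.succ - zs i.castSucc) = zs (Fin.last m) - zs 0 := by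
  induction m with
  | zero => simp
  | succ m ih =>
    rw [Fin.sum_univ_castSucc]
    have := ih fun i => zs i.castSucc
    simp only [Fin.succ_castSucc, Fin.castSucc_zero] at this ⊢
    rw [this, Fin.succ_last]
    abel

/-- An epoch is a perturbed full step. -/
lemma epoch_error_le {H : Type*} [NormedAddCommGroup H] [NormedSpace ℝ H] {a A₀ L lam M : ℝ}
    {h : Fin n → H → H} {zs ws : Fin (n + 1) → H} (ha : 0 ≤ a) (haA : a ≤ A₀) (hL : 0 ≤ L)
    (hlam : 0 < lam) (hM : 0 ≤ M)
    (hstep : ∀ i : Fin n, zs i.succ = zs i.castSucc -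
      a • (h i (ws i.castSucc) + lam⁻¹ • (zs i.castSucc - ws i.castSucc)))
    (hws : ∀ i, ‖ws i - ws 0‖ ≤ 2 * ‖zs i - zs 0‖)
    (hLip : ∀ i j, ‖h i (ws j) - h i (ws 0)‖ ≤ L * ‖ws j - ws 0‖)
    (hbd : ∀ i, ‖h i (ws 0) + lam⁻¹ • (zs 0 - ws 0)‖ ≤ M) :
    ‖zs (Fin.last n) - zs 0 + a • ∑ i, (h i (ws 0) + lam⁻¹ • (zs 0 - ws 0))‖ ≤
      n * (2 * L + 3 * lam⁻¹) * n * (1 + A₀ * (2 * L + 3 * lam⁻¹)) ^ n * a ^ 2 * M := by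
  have hdrift := inner_drift_le ha haA hL hlam hM hstep hws hLip hbd
  set Q := (1 + A₀ * (2 * L + 3 * lam⁻¹)) ^ n with hQ
  have hl : 0 < lam⁻¹ := inv_pos.2 hlam
  rw [← sum_fin_sub, Finset.smul_sum, ← Finset.sum_add_distrib]
  have hterm : ∀ i ∈ (Finset.univ : Finset (Fin n)),
      ‖zs i.succ - zs i.castSucc + a • (h i (ws 0) + lam⁻¹ • (zs 0 - ws 0))‖ ≤
        a * ((2 * L + 3 * lam⁻¹) * (n * a * M * Q)) := by
    intro i _
    have e : zs i.succ - zs i.castSucc + a • (h i (ws 0) + lam⁻¹ • (zs 0 - ws 0)) =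
        -(a • ((h i (ws i.castSucc) - h i (ws 0)) +
            lam⁻¹ • ((zs i.castSucc - zs 0) - (ws i.castSucc - ws 0)))) := by
      rw [hstep]; module
    rw [e, norm_neg, norm_smul, Real.norm_eq_abs, abs_of_nonneg ha]
    gcongr
    refine (norm_add_le _ _).trans ?_
    rw [norm_smul, Real.norm_eq_abs, abs_of_pos hl]
    have h1 := hws i.castSucc
    have h3 := (hLip i i.castSucc).trans (mul_le_mul_of_nonneg_left h1 hL)
    have h4 := mul_le_mul_of_nonneg_left
      ((norm_sub_le (zs i.castSucc - zs 0) (ws i.castSucc - ws 0)).trans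
        (add_le_add_right h1 _)) hl.le
    have h5 := mul_le_mul_of_nonneg_left (hdrift i.castSucc)
      (by positivity : 0 ≤ 2 * L + 3 * lam⁻¹)
    linarith
  refine (norm_sum_le_of_le _ hterm).trans (le_of_eq ?_)
  rw [Finset.sum_const, Finset.card_univ, Fintype.card_fin, nsmul_eq_mul]
  ring

namespace IsGenerated

variable {f : Fin n → E d → ℝ} {φ : E d → EReal} {L ρ lam : ℝ} {a : ℕ → ℝ}
  {π : ℕ → Equiv.Perm (Fin n)} {z w : ℕ → E d} {zin win : ℕ → Fin (n + 1) → E d}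

lemma eq_prox (hgen : IsGenerated f φ lam a π z w zin win) (hn : 0 < n) {k : ℕ} (hk : 1 ≤ k) :
    w k = prox lam φ (z k) := by
  induction k, hk using Nat.le_induction with
  | base => exact hgen.init
  | succ k hk _ =>
    obtain ⟨m, rfl⟩ := Nat.exists_eq_succ_of_ne_zero hn.ne'
    rw [hgen.next_w k hk, hgen.next_z k hk, ← Fin.succ_last, hgen.step_w k hk]

lemma inner_eq_prox (hgen : IsGenerated f φ lam a π z w zin win) (hn : 0 < n) {k : ℕ}
    (hk : 1 ≤ k) (i : Fin (n + 1)) : win k i = prox lam φ (zin k i) := by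
  induction i using Fin.cases with
  | zero => rw [hgen.start_w k hk, hgen.start_z k hk, hgen.eq_prox hn hk]
  | succ i => exact hgen.step_w k hk i

/-- Boundedness of `w` and the Lipschitz gradients bound the deviation of each component gradient
from the mean by `B`, so every inner direction frozen at the epoch's start has norm at most `‖F(z
k)‖ + B`. -/
lemma exists_error_bound (hgen : IsGenerated f φ lam a π z w zin win)
    (h : Regular f φ L ρ lam) {A₀ : ℝ} (ha : ∀ k, 1 ≤ k → 0 < a k) (haA : ∀ k, 1 ≤ k → a k ≤ A₀)
    (hbdd : ∃ R : ℝ, ∀ k, 1 ≤ k → ‖w k‖ ≤ R) :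
    ∃ C : ℝ, 0 ≤ C ∧ ∀ k, 1 ≤ k → ‖z (k + 1) - z k + (n * a k) • normalMap f φ lam (z k)‖ ≤
      C * a k ^ 2 * (‖normalMap f φ lam (z k)‖ + 1) := by
  obtain ⟨R, hR⟩ := hbdd
  have hn := h.pos_n
  have hL := h.pos_L.le
  have hl : 0 < lam⁻¹ := inv_pos.2 h.pos_lam
  have hR0 : 0 ≤ R := (norm_nonneg _).trans (hR 1 le_rfl)
  have hA₀ : 0 ≤ A₀ := (ha 1 le_rfl).le.trans (haA 1 le_rfl)
  have hwd : ∀ k, 1 ≤ k → w k ∈ dom φ := fun k hk => hgen.eq_prox hn hk ▸ h.prox_mem (z k)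
  have hdist : ∀ k, 1 ≤ k → L * ‖w k - w 1‖ ≤ L * (2 * R) := fun k hk => by
    gcongr
    linarith [norm_sub_le (w k) (w 1), hR k hk, hR 1 le_rfl]
  set B := ∑ i, ‖gradient (f i) (w 1)‖ + ‖gradient (smoothPart f) (w 1)‖ + 2 * (L * (2 * R))
    with hB
  have hB0 : 0 ≤ B := by positivity
  have hBd : ∀ k, 1 ≤ k → ∀ i,
      ‖gradient (f i) (w k) - gradient (smoothPart f) (w k)‖ ≤ B := fun k hk i => by
    have h1 := (h.lip i _ (hwd k hk) _ (hwd 1 le_rfl)).trans (hdist k hk)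
    have h2 := (h.lip_smooth (hwd k hk) (hwd 1 le_rfl)).trans (hdist k hk)
    have h3 := norm_sub_norm_le (gradient (f i) (w k)) (gradient (f i) (w 1))
    have h4 := norm_sub_norm_le (gradient (smoothPart f) (w k)) (gradient (smoothPart f) (w 1))
    have h5 : ‖gradient (f i) (w 1)‖ ≤ ∑ i, ‖gradient (f i) (w 1)‖ :=
      Finset.single_le_sum (f := fun i => ‖gradient (f i) (w 1)‖)
        (fun _ _ => norm_nonneg _) (Finset.mem_univ i)
    have h6 := norm_sub_le (gradient (f i) (w k)) (gradient (smoothPart f) (w k))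
    linarith
  refine ⟨n * (2 * L + 3 * lam⁻¹) * n * (1 + A₀ * (2 * L + 3 * lam⁻¹)) ^ n * (1 + B),
    by positivity, fun k hk => ?_⟩
  have hw0 : win k 0 = w k := hgen.start_w k hk
  have hz0 : zin k 0 = z k := hgen.start_z k hk
  have hwk := hgen.eq_prox hn hk
  have hwin : ∀ i, win k i ∈ dom φ := fun i => hgen.inner_eq_prox hn hk i ▸ h.prox_mem _
  have hnm : normalMap f φ lam (z k) = gradient (smoothPart f) (w k) + lam⁻¹ • (z k - w k) := by
    rw [normalMap, hwk]
  have key := epoch_error_le (h := fun i => gradient (f (π k i)))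
    (M := ‖normalMap f φ lam (z k)‖ + B) (ha k hk).le (haA k hk) hL h.pos_lam
    (by positivity) (hgen.step_z k hk)
    (fun i => by
      rw [hgen.inner_eq_prox hn hk i, hgen.inner_eq_prox hn hk 0]
      exact h.prox_lip _ _)
    (fun i j => h.lip _ _ (hwin j) _ (hwin 0))
    (fun i => by
      rw [hw0, hz0]
      have e : gradient (f (π k i)) (w k) + lam⁻¹ • (z k - w k) = normalMap f φ lam (z k) +
          (gradient (f (π k i)) (w k) - gradient (smoothPart f) (w k)) := by
        rw [hnm]; abel
      rw [e]
      exact (norm_add_le _ _).trans (add_le_add_right (hBd k hk _) _))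
  -- With all gradients frozen at `w k`, the sum over an epoch does not depend on the permutation
  -- and equals `n` times the normal map.
  have hsum : a k • ∑ i, (gradient (f (π k i)) (win k 0) + lam⁻¹ • (zin k 0 - win k 0)) =
      (n * a k) • normalMap f φ lam (z k) := by
    rw [hw0, hz0, Finset.sum_add_distrib, Finset.sum_const, Finset.card_univ, Fintype.card_fin,
      Equiv.sum_comp (π k) fun i => gradient (f i) (w k), hnm,
      (hasGradientAt_smoothPart h.diff (w k)).gradient]
    have hn' : (n : ℝ) ≠ 0 := by exact_mod_cast hn.ne'
    have e : ∑ i, gradient (f i) (w k) =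
        (n : ℝ) • ((1 / (n : ℝ)) • ∑ i, gradient (f i) (w k)) := by
      rw [smul_smul, mul_one_div_cancel hn', one_smul]
    conv_lhs => rw [e]
    rw [← Nat.cast_smul_eq_nsmul ℝ]
    module
  rw [hsum, hz0, ← hgen.next_z k hk] at key
  refine key.trans ?_
  have hX : 0 ≤ n * (2 * L + 3 * lam⁻¹) * n * (1 + A₀ * (2 * L + 3 * lam⁻¹)) ^ n * a k ^ 2 := by
    positivity
  have hG := norm_nonneg (normalMap f φ lam (z k))
  have h1 : ‖normalMap f φ lam (z k)‖ + B ≤ (1 + B) * (‖normalMap f φ lam (z k)‖ + 1) := by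
    nlinarith
  have := mul_le_mul_of_nonneg_left h1 hX
  linarith

end IsGenerated

/-! ### Descent, KL inequality and step bounds along the iterates. -/

/-- Absorption of the error terms of a perturbed step into the decrease. -/
lemma absorb_error {H₀ H₁ τ' G N a A₀ C Ce : ℝ} {m : ℕ} (hm : 0 < m) (ha : 0 < a) (haA : a ≤ A₀)
    (hC : 0 ≤ C) (hN : 0 ≤ N) (hNe : N ≤ Ce * a ^ 2 * (G + 1))
    (hsmall : a * (2 * C * m ^ 2 + Ce ^ 2 * (4 * C * A₀ + 6) * A₀) ≤ τ' * m / 8)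
    (hstep : H₁ ≤ H₀ - 3 / 8 * τ' * (m * a) * G ^ 2 +
      C * (2 * (m * a) ^ 2 * G ^ 2 + 2 * N ^ 2) + 3 * N ^ 2 / (m * a)) :
    H₁ ≤ H₀ - τ' * m / 4 * a * G ^ 2 + Ce ^ 2 * (4 * C * A₀ + 6) * a ^ 3 := by
  have hm1 : (1 : ℝ) ≤ m := by exact_mod_cast hm
  have hA₀ : 0 ≤ A₀ := ha.le.trans haA
  -- The `G²` share of the error and the second-order term together cost at most 1/8 of `τ' m a G²`
  -- by `hsmall`, which reduces 3/8 to 1/4; the constant share becomes the `a ^ 3` term.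
  have hG2 : (G + 1) ^ 2 ≤ 2 * (G ^ 2 + 1) := by nlinarith [sq_nonneg (G - 1)]
  have hN2 : N ^ 2 ≤ 2 * Ce ^ 2 * a ^ 4 * (G ^ 2 + 1) := by
    calc N ^ 2 ≤ (Ce * a ^ 2 * (G + 1)) ^ 2 := by gcongr
      _ = Ce ^ 2 * a ^ 4 * (G + 1) ^ 2 := by ring
      _ ≤ Ce ^ 2 * a ^ 4 * (2 * (G ^ 2 + 1)) := by gcongr
      _ = _ := by ring
  have h1 : C * (2 * N ^ 2) ≤ Ce ^ 2 * (4 * C * A₀) * a ^ 3 * (G ^ 2 + 1) := by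
    calc C * (2 * N ^ 2) ≤ C * (2 * (2 * Ce ^ 2 * a ^ 4 * (G ^ 2 + 1))) := by gcongr
      _ = 4 * C * Ce ^ 2 * (a * a ^ 3) * (G ^ 2 + 1) := by ring
      _ ≤ 4 * C * Ce ^ 2 * (A₀ * a ^ 3) * (G ^ 2 + 1) := by gcongr
      _ = _ := by ring
  have h2 : 3 * N ^ 2 / (m * a) ≤ Ce ^ 2 * 6 * a ^ 3 * (G ^ 2 + 1) := by
    rw [div_le_iff₀ (by positivity)]
    calc 3 * N ^ 2 ≤ 3 * (2 * Ce ^ 2 * a ^ 4 * (G ^ 2 + 1)) := by gcongr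
      _ = Ce ^ 2 * 6 * a ^ 3 * (G ^ 2 + 1) * (1 * a) := by ring
      _ ≤ _ := by gcongr
  have h3 : a ^ 3 ≤ a * A₀ * a := by
    rw [show a ^ 3 = a * a * a by ring]
    gcongr
  have hE : 0 ≤ Ce ^ 2 * (4 * C * A₀ + 6) := by positivity
  have h4 := mul_le_mul_of_nonneg_right (mul_le_mul_of_nonneg_left h3 hE) (sq_nonneg G)
  have h5 := mul_le_mul_of_nonneg_right (mul_le_mul_of_nonneg_right hsmall ha.le) (sq_nonneg G)
  linarith

lemma tau_pos {lam ρ L : ℝ} (hlam : 0 < lam) (hL : 0 < L) (hρ : 0 ≤ ρ)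
    (hlamρ : 4 * ρ * lam < 1) : 0 < tau lam ρ L := by
  have h1 : 0 ≤ ρ * lam := by positivity
  have h2 : 0 < lam ^ 2 * L ^ 2 := by positivity
  exact div_pos (by linarith) (by linarith)

/-- The merit function decreases eventually, up to a term of order `k ^ (-3 γ)`. -/
lemma Regular.exists_merit_descent {f : Fin n → E d → ℝ} {φ : E d → EReal} {L ρ lam : ℝ}
    {a : ℕ → ℝ} {z : ℕ → E d} {A₀ Ce γ τ' : ℝ} (h : Regular f φ L ρ lam)
    (hγ : 0 < γ) (ha : ∀ k, 1 ≤ k → 0 < a k)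
    (ha' : ∀ k : ℕ, 1 ≤ k → a k ≤ A₀ * (k : ℝ) ^ (-γ)) (hA₀ : 0 < A₀)
    (hτ' : 0 < τ') (hτ : τ' ≤ tau lam ρ L)
    (herr : ∀ k, 1 ≤ k → ‖z (k + 1) - z k + (n * a k) • normalMap f φ lam (z k)‖ ≤
      Ce * a k ^ 2 * (‖normalMap f φ lam (z k)‖ + 1)) :
    ∃ (K : ℕ) (C : ℝ), 1 ≤ K ∧ 0 ≤ C ∧ ∀ k : ℕ, K ≤ k →
      objReal f φ (prox lam φ (z (k + 1))) +
          τ' * lam / 2 * ‖normalMap f φ lam (z (k + 1))‖ ^ 2 ≤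
        objReal f φ (prox lam φ (z k)) + τ' * lam / 2 * ‖normalMap f φ lam (z k)‖ ^ 2 -
          τ' * n / 4 * a k * ‖normalMap f φ lam (z k)‖ ^ 2 +
          C * (k : ℝ) ^ (-(3 * γ - 1 + 1)) := by
  have hn : (0 : ℝ) < n := by exact_mod_cast h.pos_n
  have hlam := h.pos_lam
  have hL := h.pos_L
  have hρ := h.nonneg_ρ
  set C := (2 * lam * L + 3) ^ 2 / (4 * lam) + 2 / lam + 2 * (L + ρ) with hC
  have hC0 : 0 ≤ C := by positivity
  set X := 2 * C * (n : ℝ) ^ 2 + Ce ^ 2 * (4 * C * A₀ + 6) * A₀ with hX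
  have hX0 : 0 ≤ X := by positivity
  have hlim : Tendsto (fun k : ℕ => A₀ * (k : ℝ) ^ (-γ) * X) atTop (𝓝 (A₀ * 0 * X)) :=
    ((tendsto_natCast_rpow_neg hγ).const_mul A₀).mul_const X
  rw [mul_zero, zero_mul] at hlim
  obtain ⟨K, hK⟩ := eventually_atTop.1 ((hlim.eventually_le_const
    (show 0 < τ' * n / 8 by positivity)).and (eventually_ge_atTop 1))
  refine ⟨K, Ce ^ 2 * (4 * C * A₀ + 6) * A₀ ^ 3, (hK K le_rfl).2, by positivity, fun k hk => ?_⟩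
  obtain ⟨hk1, hk2⟩ := hK k hk
  have hk1' : (1 : ℝ) ≤ k := by exact_mod_cast hk2
  have hkp : (0 : ℝ) < k := by linarith
  have hak := ha k hk2
  have hak' := ha' k hk2
  have hx1 : (k : ℝ) ^ (-γ) ≤ 1 := Real.rpow_le_one_of_one_le_of_nonpos hk1' (by linarith)
  have hakA : a k ≤ A₀ := hak'.trans (mul_le_of_le_one_right hA₀.le hx1)
  have hstep := h.merit_step hτ' hτ (mul_pos hn hak)
    (e := z (k + 1) - z k + (n * a k) • normalMap f φ lam (z k)) (z := z k) (z' := z (k + 1))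
    (by abel)
  refine (absorb_error h.pos_n hak hakA hC0 (norm_nonneg _) (herr k hk2)
    ((mul_le_mul_of_nonneg_right hak' hX0).trans hk1) hstep).trans ?_
  have h3 : a k ^ 3 ≤ A₀ ^ 3 * (k : ℝ) ^ (-(3 * γ - 1 + 1)) := by
    calc a k ^ 3 ≤ (A₀ * (k : ℝ) ^ (-γ)) ^ 3 := by gcongr
      _ = _ := by
        rw [mul_pow, ← Real.rpow_natCast ((k : ℝ) ^ (-γ)), ← Real.rpow_mul hkp.le]
        congr 2; push_cast; ring
  have h4 := mul_le_mul_of_nonneg_left h3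
    (by positivity : 0 ≤ Ce ^ 2 * (4 * C * A₀ + 6))
  linarith

/-- The KL inequality at proximal points in terms of the normal map, for all larger exponents. -/
lemma HasKL.exists_real {f : Fin n → E d → ℝ} {φ : E d → EReal} {L ρ lam : ℝ}
    (h : Regular f φ L ρ lam) {wbar : E d} (hw : wbar ∈ dom φ) {θ c : ℝ}
    (hkl : HasKL (obj f φ) wbar θ c) :
    ∃ r ε : ℝ, 0 < r ∧ 0 < ε ∧ ∀ z, ‖prox lam φ z - wbar‖ < r →
      |objReal f φ (prox lam φ z) - objReal f φ wbar| < ε → ∀ θ', θ ≤ θ' → 0 < θ' →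
      |objReal f φ (prox lam φ z) - objReal f φ wbar| ^ θ' ≤ c * ‖normalMap f φ lam z‖ := by
  obtain ⟨hθ0, -, hc, η, hη, U, hU, hineq⟩ := hkl
  obtain ⟨r, hr, hrU⟩ := Metric.mem_nhds_iff.1 hU
  obtain ⟨ε, hε, hεη⟩ : ∃ ε : ℝ, 0 < ε ∧ ENNReal.ofReal ε ≤ η := by
    by_cases htop : η = ⊤
    · exact ⟨1, one_pos, htop ▸ le_top⟩
    · exact ⟨η.toReal, ENNReal.toReal_pos hη.ne' htop, (ENNReal.ofReal_toReal htop).le⟩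
  -- The bound 1 on the function gap is what allows raising the exponent.
  refine ⟨r, min 1 ε, hr, lt_min one_pos hε, fun z hz hlt θ' hθ' hθ'0 => ?_⟩
  have hG := norm_nonneg (normalMap f φ lam z)
  set x := |objReal f φ (prox lam φ z) - objReal f φ wbar| with hx
  -- The KL inequality excludes a zero gap, and `0 ^ 0 = 1`; this case is why `0 < θ'` is required.
  rcases (abs_nonneg _ : 0 ≤ x).eq_or_lt with h0 | h0
  · rw [hx, ← h0, Real.zero_rpow hθ'0.ne']
    positivity
  have habs : (obj f φ (prox lam φ z) - obj f φ wbar).abs = ENNReal.ofReal x := by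
    rw [h.obj_eq (h.prox_mem z), h.obj_eq hw, ← EReal.coe_sub, EReal.abs_def]
  have h1 := hineq (prox lam φ z) (hrU (mem_ball_iff_norm.2 hz))
    (by rw [habs]; exact ENNReal.ofReal_pos.2 h0)
    (by
      rw [habs]
      exact lt_of_lt_of_le ((ENNReal.ofReal_lt_ofReal_iff hε).2
        (hlt.trans_le (min_le_right _ _))) hεη)
  have h2 := h1.trans (mul_le_mul_right (h.stat_le z) _)
  rw [habs, ENNReal.ofReal_rpow_of_pos h0, ← ENNReal.ofReal_mul hc.le,
    ENNReal.ofReal_le_ofReal_iff (by positivity)] at h2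
  refine le_trans ?_ h2
  exact Real.rpow_le_rpow_of_exponent_ge h0 (hlt.le.trans (min_le_left _ _)) hθ'

lemma Regular.of_assumptions (hn : 0 < n) {f : Fin n → E d → ℝ} {φ : E d → EReal}
    {L ρ lam : ℝ} (hf : ∀ i, Differentiable ℝ (f i)) (hL : 0 < L)
    (hLip : ∀ i, ∀ x ∈ dom φ, ∀ y ∈ dom φ,
      ‖gradient (f i) x - gradient (f i) y‖ ≤ L * ‖x - y‖)
    (hρ : 0 ≤ ρ) (hφ_wc : IsWeaklyConvex ρ φ) (hφ_lsc : LowerSemicontinuous φ)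
    (hφ_proper : IsProper φ) (hφ_lb : ∃ φlb : ℝ, ∀ x ∈ dom φ, (φlb : EReal) ≤ φ x)
    (hlam : 0 < lam) (hlamρ : 4 * ρ * lam < 1) : Regular f φ L ρ lam where
  pos_n := hn
  diff := hf
  pos_L := hL
  lip := hLip
  nonneg_ρ := hρ
  pos_lam := hlam
  lamρ := hlamρ
  ne_bot := hφ_proper.1
  convex := hφ_wc.1
  lsc := hφ_lsc
  prox_mem z := mem_dom_of_isMinOn hφ_proper (isMinOn_prox hlam hφ_lsc hφ_proper hφ_lb z)
  sub z _ hy := weak_subgradient_of_isMinOn hlam hφ_wc hφ_proper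
    (isMinOn_prox hlam hφ_lsc hφ_proper hφ_lb z) hy

lemma Regular.objReal_ge {f : Fin n → E d → ℝ} {φ : E d → EReal} {L ρ lam flb φlb : ℝ}
    (h : Regular f φ L ρ lam) (hf : ∀ i, ∀ x ∈ dom φ, flb ≤ f i x)
    (hφ : ∀ x ∈ dom φ, (φlb : EReal) ≤ φ x) {x : E d} (hx : x ∈ dom φ) :
    flb + φlb ≤ objReal f φ x := by
  have hn : (0 : ℝ) < n := by exact_mod_cast h.pos_n
  refine add_le_add ?_ ?_
  · have := Finset.card_nsmul_le_sum Finset.univ (fun i => f i x) flb fun i _ => hf i x hx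
    rw [Finset.card_univ, Fintype.card_fin, nsmul_eq_mul] at this
    rw [smoothPart, one_div, ← div_eq_inv_mul, le_div_iff₀ hn]
    linarith
  · have := hφ x hx
    rwa [← EReal.coe_toReal hx (h.ne_bot x), EReal.coe_le_coe_iff] at this

/-- Step lengths and increments of the normal map along perturbed steps. -/
lemma Regular.step_bounds {f : Fin n → E d → ℝ} {φ : E d → EReal} {L ρ lam Ce A₀ : ℝ}
    {a : ℕ → ℝ} {z : ℕ → E d} (h : Regular f φ L ρ lam)
    (ha : ∀ k, 1 ≤ k → 0 < a k) (haA : ∀ k, 1 ≤ k → a k ≤ A₀) (hCe : 0 ≤ Ce)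
    (herr : ∀ k, 1 ≤ k → ‖z (k + 1) - z k + (n * a k) • normalMap f φ lam (z k)‖ ≤
      Ce * a k ^ 2 * (‖normalMap f φ lam (z k)‖ + 1)) :
    ∃ C : ℝ, 0 < C ∧ ∀ k, 1 ≤ k →
      ‖prox lam φ (z (k + 1)) - prox lam φ (z k)‖ ≤
        C * (a k * ‖normalMap f φ lam (z k)‖ + a k ^ 2) ∧
      ‖normalMap f φ lam (z (k + 1))‖ ≤
        ‖normalMap f φ lam (z k)‖ + C * a k * (‖normalMap f φ lam (z k)‖ + 1) := by
  have hl : 0 < lam⁻¹ := inv_pos.2 h.pos_lam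
  have hL := h.pos_L
  have hA₀ : 0 ≤ A₀ := (ha 1 le_rfl).le.trans (haA 1 le_rfl)
  have hn : (0 : ℝ) < n := by exact_mod_cast h.pos_n
  set C₁ := (n : ℝ) + Ce * A₀ + Ce with hC₁
  have hC₁0 : 0 < C₁ := by positivity
  have hz : ∀ k, 1 ≤ k → ‖z (k + 1) - z k‖ ≤
      C₁ * (a k * ‖normalMap f φ lam (z k)‖ + a k ^ 2) ∧
      ‖z (k + 1) - z k‖ ≤ C₁ * (a k * (‖normalMap f φ lam (z k)‖ + 1)) := fun k hk => by
    have hak := (ha k hk).le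
    have h1 := norm_sub_le (z (k + 1) - z k + (n * a k) • normalMap f φ lam (z k))
      ((n * a k) • normalMap f φ lam (z k))
    rw [add_sub_cancel_right, norm_smul, Real.norm_eq_abs, abs_of_nonneg (by positivity)] at h1
    have h2 := herr k hk
    have hG := norm_nonneg (normalMap f φ lam (z k))
    generalize ‖normalMap f φ lam (z k)‖ = G at *
    have h3 : Ce * a k * (a k * G) ≤ Ce * A₀ * (a k * G) := by
      have := haA k hk
      gcongr
    have h4 : Ce * a k * (a k * 1) ≤ Ce * A₀ * (a k * 1) := by
      have := haA k hk
      gcongr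
    have p1 : 0 ≤ (n : ℝ) * a k := by positivity
    have p2 : 0 ≤ Ce * (a k * G) := by positivity
    have p3 : 0 ≤ ((n : ℝ) + Ce * A₀) * a k ^ 2 := by positivity
    have p4 : 0 ≤ Ce * a k := by positivity
    constructor
    · rw [hC₁]; linarith
    · rw [hC₁]; linarith
  refine ⟨C₁ * (2 + (2 * L + 3 * lam⁻¹)), by positivity, fun k hk => ?_⟩
  have hak := (ha k hk).le
  obtain ⟨h1, h2⟩ := hz k hk
  have hG := norm_nonneg (normalMap f φ lam (z k))
  constructor
  · refine (h.prox_lip _ _).trans ?_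
    have p : 0 ≤ C₁ * (2 * L + 3 * lam⁻¹) * (a k * ‖normalMap f φ lam (z k)‖ + a k ^ 2) := by
      positivity
    linarith
  · have h3 := h.normalMap_lip (z k) (z (k + 1))
    have h4 := norm_sub_norm_le (normalMap f φ lam (z (k + 1))) (normalMap f φ lam (z k))
    have h5 := mul_le_mul_of_nonneg_left h2 (by positivity : 0 ≤ 2 * L + 3 * lam⁻¹)
    have p : 0 ≤ C₁ * (a k * (‖normalMap f φ lam (z k)‖ + 1)) := by positivity
    linarith

lemma exists_accPt {w : ℕ → E d} (hbdd : ∃ R : ℝ, ∀ k, 1 ≤ k → ‖w k‖ ≤ R) :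
    ∃ wbar, ∃ l : ℕ → ℕ, StrictMono l ∧ (∀ j, 1 ≤ l j) ∧
      Tendsto (fun j => w (l j)) atTop (𝓝 wbar) := by
  obtain ⟨R, hR⟩ := hbdd
  obtain ⟨x, -, l, hl, hx⟩ := tendsto_subseq_of_bounded
    (Metric.isBounded_closedBall (x := (0 : E d)) (r := R)) (x := fun k => w (k + 1))
    fun k => by
      rw [mem_closedBall_zero_iff]
      exact hR _ (by omega)
  exact ⟨x, fun j => l j + 1, fun _ _ hij => Nat.add_lt_add_right (hl hij) 1, fun _ => Nat.le_add_left 1 _, hx⟩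

lemma isBigO_rpow_of_le {u : ℕ → ℝ} {M s : ℝ} (hu : ∀ k, 0 ≤ u k)
    (h : ∀ᶠ k : ℕ in atTop, u k ≤ M * (k : ℝ) ^ (-s)) :
    u =O[atTop] fun k : ℕ => (k : ℝ) ^ (-s) := by
  refine Asymptotics.IsBigO.of_bound M ?_
  filter_upwards [h] with k hk
  rw [Real.norm_eq_abs, abs_of_nonneg (hu k), Real.norm_eq_abs, abs_of_nonneg (by positivity)]
  exact hk

lemma Regular.hasRate_residual {f : Fin n → E d → ℝ} {φ : E d → EReal} {L ρ lam M r : ℝ}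
    (h : Regular f φ L ρ lam) {z w : ℕ → E d} {wbar : E d} (hwbar : wbar ∈ dom φ)
    (hwz : ∀ k, 1 ≤ k → w k = prox lam φ (z k)) (hM : 0 < M)
    (hr : ∀ᶠ k : ℕ in atTop, ‖normalMap f φ lam (z k)‖ ^ 2 ≤ M * (k : ℝ) ^ (-r) ∧
      |objReal f φ (prox lam φ (z k)) - objReal f φ wbar| ≤ M * (k : ℝ) ^ (-r)) :
    HasRate (fun k => residual (obj f φ) wbar (w k)) r := by
  refine ⟨M, hM, ?_⟩
  filter_upwards [hr, eventually_ge_atTop 1] with k ⟨hk1, hk2⟩ hk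
  rw [residual, hwz k hk]
  refine max_le ?_ ?_
  · calc stat (obj f φ) (prox lam φ (z k)) ^ 2
        ≤ ENNReal.ofReal ‖normalMap f φ lam (z k)‖ ^ 2 := by
          gcongr; exact h.stat_le (z k)
      _ = ENNReal.ofReal (‖normalMap f φ lam (z k)‖ ^ 2) :=
          (ENNReal.ofReal_pow (norm_nonneg _) 2).symm
      _ ≤ _ := ENNReal.ofReal_le_ofReal hk1
  · rw [h.obj_eq (h.prox_mem _), h.obj_eq hwbar, ← EReal.coe_sub, EReal.abs_def]
    exact ENNReal.ofReal_le_ofReal hk2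

lemma distance_rate {u δ : ℕ → ℝ} {M M' θ q v r s : ℝ} (hθ : θ ≤ 1) (hM : 0 ≤ M) (hM' : 0 ≤ M')
    (hsr : s ≤ r * (1 - θ)) (hsq : s ≤ q) (hsv : s ≤ v)
    (hδ0 : ∀ᶠ k in atTop, 0 ≤ δ k) (hδ : ∀ᶠ k : ℕ in atTop, δ k ≤ M' * (k : ℝ) ^ (-r))
    (h : ∀ᶠ k : ℕ in atTop, u k ≤ M * (δ k ^ (1 - θ) + (k : ℝ) ^ (-q) + (k : ℝ) ^ (-v))) :
    ∀ᶠ k : ℕ in atTop, u k ≤ M * (M' ^ (1 - θ) + 1 + 1) * (k : ℝ) ^ (-s) := by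
  filter_upwards [hδ0, hδ, h, eventually_ge_atTop 1] with k h1 h2 h3 hk
  have hk1 : (1 : ℝ) ≤ k := by exact_mod_cast hk
  have hkp : (0 : ℝ) < k := by linarith
  have e1 : δ k ^ (1 - θ) ≤ M' ^ (1 - θ) * (k : ℝ) ^ (-s) := by
    calc δ k ^ (1 - θ) ≤ (M' * (k : ℝ) ^ (-r)) ^ (1 - θ) :=
          Real.rpow_le_rpow h1 h2 (by linarith)
      _ = M' ^ (1 - θ) * (k : ℝ) ^ (-r * (1 - θ)) := by
          rw [Real.mul_rpow hM' (by positivity), ← Real.rpow_mul hkp.le]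
      _ ≤ _ := by
          refine mul_le_mul_of_nonneg_left ?_ (by positivity)
          exact Real.rpow_le_rpow_of_exponent_le hk1 (by linarith)
  have e2 : (k : ℝ) ^ (-q) ≤ (k : ℝ) ^ (-s) :=
    Real.rpow_le_rpow_of_exponent_le hk1 (by linarith)
  have e3 : (k : ℝ) ^ (-v) ≤ (k : ℝ) ^ (-s) :=
    Real.rpow_le_rpow_of_exponent_le hk1 (by linarith)
  refine h3.trans ?_
  rw [mul_assoc]
  refine mul_le_mul_of_nonneg_left ?_ hM
  linarith

end NormPRR

/-! ### Assembly: convergence and the three rates. -/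

theorem theorem24 {d n : ℕ} (hn : 0 < n)
    (f : Fin n → NormPRR.E d → ℝ) (φ : NormPRR.E d → EReal)
    (L ρ lam α β γ : ℝ)
    -- the component functions are differentiable with Lipschitz gradients on the domain
    (hf : ∀ i, Differentiable ℝ (f i))
    (hL : 0 < L)
    (hLip : ∀ i, ∀ x ∈ NormPRR.dom φ, ∀ y ∈ NormPRR.dom φ,
      ‖gradient (f i) x - gradient (f i) y‖ ≤ L * ‖x - y‖)
    -- the nonsmooth part is weakly convex, lower semicontinuous and proper
    (hρ : 0 ≤ ρ)
    (hφ_wc : NormPRR.IsWeaklyConvex ρ φ)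
    (hφ_lsc : LowerSemicontinuous φ)
    (hφ_proper : NormPRR.IsProper φ)
    -- lower bounds on the domain
    (hf_lb : ∃ flb : ℝ, ∀ i, ∀ x ∈ NormPRR.dom φ, flb ≤ f i x)
    (hφ_lb : ∃ φlb : ℝ, ∀ x ∈ NormPRR.dom φ, (φlb : EReal) ≤ φ x)
    -- parameters and step sizes
    (hlam : 0 < lam) (hlamρ : 4 * ρ * lam < 1)
    (hα : 0 < α) (hβ : 0 ≤ β) (hγ : 1 / 2 < γ) (hγ' : γ ≤ 1)
    (π : ℕ → Equiv.Perm (Fin n))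
    (z w : ℕ → NormPRR.E d) (zin win : ℕ → Fin (n + 1) → NormPRR.E d)
    (hgen : NormPRR.IsGenerated f φ lam (fun k => α / (β + (k : ℝ)) ^ γ) π z w zin win)
    -- boundedness of the iterates and KL property at all accumulation points
    (hbdd : ∃ R : ℝ, ∀ k, 1 ≤ k → ‖w k‖ ≤ R)
    (hKL : ∀ wbar ∈ NormPRR.accPts w, ∃ θ c : ℝ, NormPRR.HasKL (NormPRR.obj f φ) wbar θ c) :
    ∃ wstar ∈ NormPRR.crit (NormPRR.obj f φ),
      Filter.Tendsto w Filter.atTop (nhds wstar) ∧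
      ∀ θ c : ℝ, NormPRR.HasKL (NormPRR.obj f φ) wstar θ c →
        (γ < 1 → θ < γ / (3 * γ - 1) →
          NormPRR.HasRate (fun k => NormPRR.residual (NormPRR.obj f φ) wstar (w k))
              (3 * γ - 1) ∧
            (fun k => ‖w k - wstar‖) =O[Filter.atTop]
              (fun k : ℕ => (k : ℝ) ^ (-(2 * γ - 1)))) ∧
        (γ < 1 → γ / (3 * γ - 1) ≤ θ →
          NormPRR.HasRate (fun k => NormPRR.residual (NormPRR.obj f φ) wstar (w k))
              ((1 - γ) / (2 * θ - 1)) ∧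
            (fun k => ‖w k - wstar‖) =O[Filter.atTop]
              (fun k : ℕ => (k : ℝ) ^ (-((1 - θ) * (1 - γ) / (2 * θ - 1))))) ∧
        (γ = 1 → θ ≤ 1 / 2 →
          16 * NormPRR.adjustedConst lam ρ L c ^ 2 / (NormPRR.tau lam ρ L * n) < α →
          NormPRR.HasRate (fun k => NormPRR.residual (NormPRR.obj f φ) wstar (w k)) 2 ∧
            (fun k => ‖w k - wstar‖) =O[Filter.atTop] (fun k : ℕ => (k : ℝ) ^ (-1 : ℝ))) := by
  have h : NormPRR.Regular f φ L ρ lam := NormPRR.Regular.of_assumptions hn hf hL hLip hρ hφ_wc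
    hφ_lsc hφ_proper hφ_lb hlam hlamρ
  obtain ⟨flb, hflb⟩ := hf_lb
  obtain ⟨φlb, hφlb⟩ := hφ_lb
  set a : ℕ → ℝ := fun k => α / (β + (k : ℝ)) ^ γ with ha_def
  have hγ0 : 0 < γ := by linarith
  have hp : 0 < 3 * γ - 1 := by linarith
  have hn' : (0 : ℝ) < n := by exact_mod_cast hn
  set a₀ := α / (1 + β) ^ γ with ha₀_def
  have ha₀ : 0 < a₀ := by positivity
  have halo : ∀ k : ℕ, 1 ≤ k → a₀ * (k : ℝ) ^ (-γ) ≤ a k := fun k hk =>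
    (NormPRR.stepsize_bounds hα hβ hγ0 hk).1
  have hahi : ∀ k : ℕ, 1 ≤ k → a k ≤ α * (k : ℝ) ^ (-γ) := fun k hk =>
    (NormPRR.stepsize_bounds hα hβ hγ0 hk).2
  have hapos : ∀ k, 1 ≤ k → 0 < a k := fun k hk => by
    have : (0 : ℝ) < k := by exact_mod_cast hk
    simp only [ha_def]
    positivity
  have haα : ∀ k, 1 ≤ k → a k ≤ α := fun k hk => (hahi k hk).trans
    (mul_le_of_le_one_right hα.le (Real.rpow_le_one_of_one_le_of_nonpos
      (by exact_mod_cast hk) (by linarith)))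
  have hwz : ∀ k, 1 ≤ k → w k = NormPRR.prox lam φ (z k) := fun k hk => hgen.eq_prox hn hk
  obtain ⟨Ce, hCe, herr⟩ := hgen.exists_error_bound h hapos haα hbdd
  set G : ℕ → ℝ := fun k => ‖NormPRR.normalMap f φ lam (z k)‖ with hG_def
  set Ψ : ℕ → ℝ := fun k => NormPRR.objReal f φ (NormPRR.prox lam φ (z k)) with hΨ_def
  have hG : ∀ k, 0 ≤ G k := fun k => norm_nonneg _
  obtain ⟨Cs, hCs, hsteps⟩ := h.step_bounds hapos haα hCe herr
  have hτ := NormPRR.tau_pos hlam hL hρ hlamρ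
  set τ := NormPRR.tau lam ρ L with hτ_def
  obtain ⟨K₁, C₁, hK₁, hC₁, hdesc₁⟩ := h.exists_merit_descent hγ0 hapos hahi hα hτ le_rfl herr
  -- The second merit function, with half the weight, serves only to extract `G²` and `|Ψ - l|` from
  -- a rate of the first gap.
  obtain ⟨K₂, C₂, hK₂, hC₂, hdesc₂⟩ := h.exists_merit_descent hγ0 hapos hahi hα (half_pos hτ)
    (half_le_self hτ.le) herr
  have hb : 0 < τ * n / 4 := by positivity
  have hσ : 0 < τ * lam / 2 := by positivity
  obtain ⟨hG0, l, hΨl⟩ := NormPRR.tendsto_of_perturbed_descent (G := G) (Ψ := Ψ) hK₁ hγ hγ' hp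
    ha₀ hα hb hσ hC₁ hCs.le hG halo hahi hdesc₁
    (fun k _ => h.objReal_ge hflb hφlb (h.prox_mem _)) (fun k hk => (hsteps k hk).2)
  obtain ⟨D₁, hD₁, hgap₁⟩ := NormPRR.exists_meritGap hK₁ hp hb hC₁ (fun k hk => (hapos k hk).le)
    hdesc₁ hG0 hΨl
  obtain ⟨D₂, hD₂, hgap₂⟩ := NormPRR.exists_meritGap hK₂ hp (by positivity) hC₂
    (fun k hk => (hapos k hk).le) hdesc₂ hG0 hΨl
  have hgap0 := NormPRR.tendsto_meritGap (σ := τ * lam / 2) (D := D₁) hp hG0 hΨl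
  -- an accumulation point
  obtain ⟨wbar, s, hs, hs1, hsw⟩ := NormPRR.exists_accPt hbdd
  have hsw' : Tendsto (fun j => NormPRR.prox lam φ (z (s j))) atTop (𝓝 wbar) :=
    hsw.congr fun j => hwz _ (hs1 j)
  -- `hwl` identifies the limit `l` with the objective value at `wbar`, so the KL inequality there
  -- concerns `Ψ k - l`.
  obtain ⟨hwdom, hwcrit, hwl⟩ := h.mem_crit_of_tendsto (z := fun j => z (s j)) hsw'
    (tendsto_zero_iff_norm_tendsto_zero.2 (hG0.comp hs.tendsto_atTop))
    (hΨl.comp hs.tendsto_atTop)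
  have hcl : ∀ ε : ℝ, 0 < ε → ∃ᶠ k in atTop, ‖w k - wbar‖ < ε := fun ε hε => by
    have h1 := (tendsto_iff_norm_sub_tendsto_zero.1 hsw).eventually_lt_const hε
    exact hs.tendsto_atTop.frequently h1.frequently
  -- the KL inequality along the sequence
  have hKLreal : ∀ θ c, NormPRR.HasKL (NormPRR.obj f φ) wbar θ c → ∃ (r : ℝ) (K : ℕ), 0 < r ∧
      ∀ k, K ≤ k → ‖w k - wbar‖ < r → ∀ θ', θ ≤ θ' → 0 < θ' → |Ψ k - l| ^ θ' ≤ c * G k := by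
    intro θ c hkl
    obtain ⟨r, ε, hr, hε, hineq⟩ := hkl.exists_real h hwdom
    have h1 := (tendsto_iff_norm_sub_tendsto_zero.1 hΨl).eventually_lt_const hε
    obtain ⟨K, hK⟩ := eventually_atTop.1 (h1.and (eventually_ge_atTop 1))
    refine ⟨r, K, hr, fun k hk hkr θ' hθ' hθ'0 => ?_⟩
    obtain ⟨h2, h3⟩ := hK k hk
    have h4 := hineq (z k) (by rwa [← hwz k h3]) (by rwa [hwl]) θ' hθ' hθ'0
    rwa [hwl] at h4
  -- convergence with a distance estimate, for admissible exponents
  have hconv : ∀ θ c θ', NormPRR.HasKL (NormPRR.obj f φ) wbar θ c → θ ≤ θ' → 1 / 2 ≤ θ' →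
      θ' < 1 → 0 < γ + θ' * (3 * γ - 1) - 1 → Tendsto w atTop (𝓝 wbar) ∧ ∃ M : ℝ, 0 < M ∧
      ∀ᶠ k : ℕ in atTop, ‖w k - wbar‖ ≤
        M * (NormPRR.meritGap Ψ G l (τ * lam / 2) D₁ (3 * γ - 1) k ^ (1 - θ') +
          (k : ℝ) ^ (-(γ + θ' * (3 * γ - 1) - 1)) + (k : ℝ) ^ (-(2 * γ - 1))) := by
    intro θ c θ' hkl hθθ' hθ' hθ'1 hq
    obtain ⟨r, K, hr, hineq⟩ := hKLreal θ c hkl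
    obtain ⟨K', hK'⟩ := eventually_atTop.1 (hG0.eventually_le_const zero_lt_one)
    refine NormPRR.tendsto_of_KL (K := max (max K K') K₁) (hK₁.trans (le_max_right _ _)) hγ hb
      hσ.le hD₁.le hCs hr hθ' hθ'1 hq hα hapos hahi hG
      (fun k hk => hK' k ((le_max_right _ _).trans ((le_max_left _ _).trans hk)))
      (fun k hk => hgap₁ k ((le_max_right _ _).trans hk)) hgap0 (fun k hk => ?_)
      (fun k hk hkr => hineq k ((le_max_left _ _).trans ((le_max_left _ _).trans hk)) hkr θ' hθθ'
        (by linarith)) hcl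
    rw [hwz k hk, hwz (k + 1) (by omega)]
    exact (hsteps k hk).1
  have hlim : Tendsto w atTop (𝓝 wbar) := by
    obtain ⟨θ, c, hkl⟩ := hKL wbar ⟨s, hs, hsw⟩
    -- The midpoint of `(1 - γ) / (3γ - 1)` and 1, which equals `γ / (3γ - 1)`; it makes the
    -- summability margin `γ + θ₁ (3γ - 1) - 1` equal to `2γ - 1 > 0`.
    set θ₁ := ((1 - γ) / (3 * γ - 1) + 1) / 2 with hθ₁
    have h1 : (1 - γ) / (3 * γ - 1) < 1 := by rw [div_lt_one hp]; linarith
    have h2 : 0 ≤ (1 - γ) / (3 * γ - 1) := div_nonneg (by linarith) hp.le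
    have h3 : θ₁ * (3 * γ - 1) = γ := by
      have : (1 - γ) / (3 * γ - 1) * (3 * γ - 1) = 1 - γ := div_mul_cancel₀ _ hp.ne'
      rw [hθ₁]
      generalize (1 - γ) / (3 * γ - 1) = x at *
      linarith
    refine (hconv θ c (max θ θ₁) hkl (le_max_left _ _)
      (le_trans (by linarith) (le_max_right _ _)) (max_lt hkl.2.1 (by linarith)) ?_).1
    have h4 := mul_le_mul_of_nonneg_right (le_max_right θ θ₁) hp.le
    linarith
  refine ⟨wbar, ⟨?_, hwcrit⟩, hlim, fun θ c hkl => ?_⟩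
  · rw [NormPRR.dom, Set.mem_ofPred_eq, h.obj_eq hwdom]
    exact EReal.coe_ne_top _
  have hKLev : ∀ θ', θ ≤ θ' → 0 < θ' → ∀ᶠ k in atTop, |Ψ k - l| ^ θ' ≤ c * G k := by
    obtain ⟨r, K, hr, hineq⟩ := hKLreal θ c hkl
    intro θ' hθ' hθ'0
    filter_upwards [(tendsto_iff_norm_sub_tendsto_zero.1 hlim).eventually_lt_const hr,
      eventually_ge_atTop K] with k hk1 hk2
    exact hineq k hk2 hk1 θ' hθ' hθ'0
  have hgapnn : ∀ᶠ k in atTop, 0 ≤ NormPRR.meritGap Ψ G l (τ * lam / 2) D₁ (3 * γ - 1) k :=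
    eventually_atTop.2 ⟨K₁, fun k hk => (hgap₁ k hk).1⟩
  -- rates from a rate of the merit gap
  have hrates : ∀ r v θ', (∃ M : ℝ, 0 < M ∧ ∀ᶠ k : ℕ in atTop,
        NormPRR.meritGap Ψ G l (τ * lam / 2) D₁ (3 * γ - 1) k ≤ M * (k : ℝ) ^ (-r)) →
      r ≤ 3 * γ - 1 → θ ≤ θ' → 1 / 2 ≤ θ' → θ' < 1 → 0 < γ + θ' * (3 * γ - 1) - 1 →
      v ≤ r * (1 - θ') → v ≤ γ + θ' * (3 * γ - 1) - 1 → v ≤ 2 * γ - 1 →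
      NormPRR.HasRate (fun k => NormPRR.residual (NormPRR.obj f φ) wbar (w k)) r ∧
        (fun k => ‖w k - wbar‖) =O[atTop] (fun k : ℕ => (k : ℝ) ^ (-v)) := by
    rintro r v θ' ⟨M, hM, hr⟩ hrp hθθ' hθ' hθ'1 hq hv1 hv2 hv3
    obtain ⟨M', hM', hres⟩ := NormPRR.sq_and_abs_rate (σ' := τ / 2 * lam / 2) (by positivity)
      (by linarith) hD₁.le hD₂.le hM hrp
      (eventually_atTop.2 ⟨K₂, fun k hk => (hgap₂ k hk).1⟩) hr
    obtain ⟨-, M₃, hM₃, hdist⟩ := hconv θ c θ' hkl hθθ' hθ' hθ'1 hq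
    exact ⟨h.hasRate_residual hwdom hwz hM' (by rwa [hwl]),
      NormPRR.isBigO_rpow_of_le (fun _ => norm_nonneg _)
        (NormPRR.distance_rate hθ'1.le hM₃.le hM.le hv1 hv2 hv3 hgapnn hr hdist)⟩
  have hgapKL : ∀ θ' r, 1 / 2 ≤ θ' → θ' < 1 → 0 ≤ r → r ≤ 3 * γ - 1 →
      (γ + (2 * θ' - 1) * r < 1 ∨ γ + (2 * θ' - 1) * r = 1 ∧ 1 < 2 * θ') →
      (∀ᶠ k in atTop, |Ψ k - l| ^ θ' ≤ c * G k) → ∃ M : ℝ, 0 < M ∧ ∀ᶠ k : ℕ in atTop,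
        NormPRR.meritGap Ψ G l (τ * lam / 2) D₁ (3 * γ - 1) k ≤ M * (k : ℝ) ^ (-r) := by
    intro θ' r hθ' hθ'1 hr hrp hq hkl'
    obtain ⟨K', hK'⟩ := eventually_atTop.1 (hG0.eventually_le_const zero_lt_one)
    exact NormPRR.gap_rate_of_KL (G := G) (Ψ := Ψ) (a := a) (D := D₁) (c := c) (l := l) (θ := θ')
      (r := r) (p := 3 * γ - 1) (K := max K' K₁)
      (hK₁.trans (le_max_right _ _)) hγ0 hb hσ.le hD₁.le ha₀ hθ' hθ'1 hr hrp hq halo hG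
      (fun k hk => hK' k ((le_max_left _ _).trans hk))
      (fun k hk => hgap₁ k ((le_max_right _ _).trans hk)) hkl'
  have hθ1 : θ < 1 := hkl.2.1
  have hγp1 : γ / (3 * γ - 1) < 1 := by rw [div_lt_one hp]; linarith
  have hγp2 : 1 / 2 ≤ γ / (3 * γ - 1) := by rw [div_le_div_iff₀ two_pos hp]; linarith
  have hγp3 : γ / (3 * γ - 1) * (3 * γ - 1) = γ := div_mul_cancel₀ _ hp.ne'
  refine ⟨fun hγ1 hθγ => ?_, fun hγ1 hθγ => ?_, fun hγ1 hθ2 hα2 => ?_⟩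
  -- Two exponents are used. At `γ / (3γ - 1)` all three terms of the distance bound have order `2γ
  -- - 1`. The gap itself uses `max θ (1 / 2)`, which lies strictly below, so the recursion is
  -- subcritical and the full order `3γ - 1` is reached.
  · refine hrates (3 * γ - 1) (2 * γ - 1) (γ / (3 * γ - 1)) ?_ le_rfl hθγ.le hγp2 hγp1
      (by linarith) (by linarith) (by linarith) le_rfl
    have h12 : 1 / 2 < γ / (3 * γ - 1) := by rw [div_lt_div_iff₀ two_pos hp]; linarith
    have h1 : max θ (1 / 2) * (3 * γ - 1) < γ := by
      rw [← lt_div_iff₀ hp]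
      exact max_lt hθγ h12
    refine hgapKL (max θ (1 / 2)) _ (le_max_right _ _) (max_lt hθ1 (by norm_num)) hp.le le_rfl
      (Or.inl (by linarith)) (hKLev _ (le_max_left _ _) (lt_max_of_lt_right (by norm_num)))
  · have h1 : γ ≤ θ * (3 * γ - 1) := by rwa [div_le_iff₀ hp] at hθγ
    have h12 : 1 / 2 < γ / (3 * γ - 1) := by rw [div_lt_div_iff₀ two_pos hp]; linarith
    have hθ2 : 0 < 2 * θ - 1 := by linarith
    have hr0 : 0 ≤ (1 - γ) / (2 * θ - 1) := div_nonneg (by linarith) hθ2.le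
    have hrp : (1 - γ) / (2 * θ - 1) ≤ 3 * γ - 1 := by rw [div_le_iff₀ hθ2]; linarith
    have hv : (1 - θ) * (1 - γ) / (2 * θ - 1) ≤ 2 * γ - 1 := by
      rw [mul_div_assoc]
      calc (1 - θ) * ((1 - γ) / (2 * θ - 1)) ≤ (1 - θ) * (3 * γ - 1) :=
            mul_le_mul_of_nonneg_left hrp (by linarith)
        _ ≤ _ := by linarith
    refine hrates _ _ θ ?_ hrp le_rfl (by linarith) hθ1 (by linarith)
      (le_of_eq (by ring)) (by linarith) hv
    -- This `r` solves `γ + (2θ - 1) r = 1`, the critical case of the recursion, allowed since `2θ >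
    -- 1`.
    exact hgapKL θ _ (by linarith) hθ1 hr0 hrp
      (Or.inr ⟨by rw [mul_div_cancel₀ _ hθ2.ne']; ring, by linarith⟩)
      (hKLev θ le_rfl (by linarith))
  · subst hγ1
    have e2 : (3 * 1 - 1 : ℝ) = 2 := by norm_num
    rw [e2] at hrates hgap₁
    refine hrates 2 1 (1 / 2) ?_ le_rfl hθ2 le_rfl (by norm_num) (by norm_num) (by norm_num)
      (by norm_num) (by norm_num)
    set cc := NormPRR.adjustedConst lam ρ L c with hcc
    obtain ⟨α', hα'1, hα'2⟩ := exists_between hα2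
    have hc : 0 < c := hkl.2.2.1
    have hcc2 : c ^ 2 + τ * lam / 2 ≤ cc ^ 2 := by
      rw [hcc, NormPRR.adjustedConst, ← hτ_def]
      have m1 : 1 ≤ max 1 (τ * lam / 2) := le_max_left _ _
      have m2 : τ * lam / 2 ≤ max 1 (τ * lam / 2) := le_max_right _ _
      nlinarith
    have hα'0 : 16 * cc ^ 2 < α' * (τ * n) := by
      rwa [div_lt_iff₀ (by positivity)] at hα'1
    have hcc0 : 0 < cc ^ 2 := lt_of_lt_of_le (by positivity) hcc2
    -- With `b = τ n / 4` and `σ = τ λ / 2` the requirement reads `8 (c² + σ) < α' τ n`, which the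
    -- assumed `16 c̃²` implies through `hcc2`.
    exact NormPRR.gap_rate_of_KL_half hK₁ hb hσ hD₁.le (α' := α') (by linarith)
      (NormPRR.eventually_stepsize_ge hα'2 hβ) hgap₁ (hKLev _ hθ2 (by norm_num))
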